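/- A triangulation of the $2$-sphere is a finite simplicial complex whose underlying space is homeomorphic to the $2$-sphere. The degree of a vertex is the number of edges containing it, and two distinct vertices are adjacent if they are the endpoints of an edge. **Theorem.** Let $k$ be a positive integer. If a triangulation of the $2$-sphere has exactly two vertices whose degrees are not divisible by $k$, then these two vertices are not adjacent. -/

import Mathlib

namespace Geometry.SimplicialComplex

variable {E : Type*} [NormedAddCommGroup E] [NormedSpace ℝ E]

/-- A (finite, geometric) simplicial complex is a triangulation of the 2-sphere if its underlying
space, with the topology induced from the ambient space, is homeomorphic to the unit sphere
of `ℝ³`. -/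
def TriangulatesSphere (K : SimplicialComplex ℝ E) : Prop :=
  K.faces.Finite ∧ Nonempty (K.space ≃ₜ Metric.sphere (0 : EuclideanSpace ℝ (Fin 3)) 1)

/-- The edge graph (1-skeleton) of a simplicial complex: two distinct points are adjacent if they
are the two endpoints of an edge. -/
def edgeGraph (K : SimplicialComplex ℝ E) : SimpleGraph E where
  Adj v w := v ≠ w ∧ ∃ e ∈ K.faces, (e : Set E) = {v, w}
  symm := ⟨fun v w h => ⟨h.1.symm, by simpa only [Set.pair_comm w v] using h.2⟩⟩
  loopless := ⟨fun _ h => h.1 rfl⟩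

/-- The degree of a vertex: the number of edges at it, that is, of vertices adjacent to it. -/
noncomputable def vertexDegree (K : SimplicialComplex ℝ E) (v : E) : ℕ :=
  (K.edgeGraph.neighborSet v).ncard

end Geometry.SimplicialComplex

set_option linter.unusedSectionVars false

/-! Suppose the exceptional vertices `a`, `b` are adjacent. The triangulation is developed onto the
regular tiling with `k` triangles at each vertex, and a linear functional on the ambient space is
followed. With `θ = 2π/k`, opposite corners of triangles `{u, v, w}`, `{u, v, w'}` in the tiling
satisfy `w' = -w + 2 cos θ (u + v)` (for `k = 2` simply `w' = w`), so each triangle carries three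
real labels and each edge imposes the rule `Glues`. Around a vertex the rule is a recurrence of
period `k`, hence it closes up wherever `k` divides the degree.

Choose a spanning tree containing the edge `ab`. The dual graph of the edges outside it is acyclic
(`dualGraph_isAcyclic`), so labels obeying the rule across those edges exist with any start
(`exists_consistent_labelling`). Going from the leaves towards `a`, divisibility of the degrees
yields the rule across every tree edge except `ab` (`consistentAt_of_dvd`). Start with labels `0, 1,
cos θ` at `a`, `b`, `c`. A turn around `a`, of degree `d`, brings the label of `b` to `cos (dθ)`; a
turn around `b` leaves it at `1`. Both turns end in the second triangle at `ab`, so `cos (dθ) = 1`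
and `k ∣ d` (`dvd_degree_of_adj`).

The topology enters only through the fact that the sphere minus a point is a plane. With one
puncture the space is simply connected, so mod 2 cocycles split; with two, some nowhere vanishing
function has no square root, so some cocycle does not split. Reading both on the nerve of a cover by
shrunken open stars gives that maximal faces are triangles, that each edge lies in exactly two of
them, that vertex links are connected, and that the first mod 2 cohomology vanishes. -/

/-! ### Square roots and mod 2 cocycles of covers -/

/-- A nowhere vanishing complex function on a contractible space has a continuous square root. -/
theorem exists_continuous_sqrt_of_contractible {A : Type*} [TopologicalSpace A]
    [ContractibleSpace A] (g : C(A, ℂ)) (hg : ∀ a, g a ≠ 0) :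
    ∃ s : C(A, ℂ), ∀ a, s a ^ 2 = g a := by
  have cov := isCoveringMap_npow (𝕜 := ℂ) 2 (by norm_num)
  obtain ⟨a₀, ⟨H⟩⟩ := id_nullhomotopic A
  let g' : C(A, {z : ℂ // z ≠ 0}) := ⟨fun a => ⟨g a, hg a⟩, by fun_prop⟩
  obtain ⟨r, hr⟩ := IsAlgClosed.exists_pow_nat_eq (g a₀) (n := 2) (by norm_num)
  have hr0 : r ≠ 0 := by
    rintro rfl
    exact hg a₀ (by rw [← hr]; norm_num)
  -- The reversed contraction runs from a constant map to the identity. The constant root `r` starts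
  -- the lift through the squaring cover, and the lift at time `1` is the root of `g`.
  let F : C(unitInterval × A, {z : ℂ // z ≠ 0}) := g'.comp H.symm.toContinuousMap
  have hF0 : ∀ a, F (0, a) = (fun x : {x : ℂ // x ≠ 0} ↦
      (⟨x ^ 2, pow_ne_zero 2 x.2⟩ : {x : ℂ // x ≠ 0})) (ContinuousMap.const A ⟨r, hr0⟩ a) := by
    intro a
    apply Subtype.ext
    simp [F, g', hr]
  have hl := cov.liftHomotopy_lifts F (ContinuousMap.const A ⟨r, hr0⟩) hF0
  refine ⟨⟨fun a => (cov.liftHomotopy F (ContinuousMap.const A ⟨r, hr0⟩) hF0 (1, a) : ℂ),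
    by fun_prop⟩, fun a => ?_⟩
  have := congrArg Subtype.val (congrFun hl (1, a))
  simpa [F, g'] using this

/-- The identity of the punctured plane has no continuous square root. -/
theorem not_exists_continuous_sqrt_punctured_plane :
    ¬ ∃ s : {z : ℂ // z ≠ 0} → ℂ, Continuous s ∧ ∀ z, s z ^ 2 = z := by
  rintro ⟨s, hs, h⟩
  let u : ℝ → {z : ℂ // z ≠ 0} := fun θ => ⟨Complex.exp (2 * θ * Complex.I), Complex.exp_ne_zero _⟩
  have hu : Continuous u := by fun_prop
  -- This compares the root at `exp (2iθ)` with `exp (iθ)`. The quotient is a sign, hence constant,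
  -- yet it changes sign from `0` to `π`, where `u` has closed up.
  let f : ℝ → ℂ := fun θ => s (u θ) * Complex.exp (-(θ * Complex.I))
  have hf : Continuous f := by fun_prop
  have hf2 : ∀ θ, f θ ^ 2 = 1 := by
    intro θ
    simp only [f, mul_pow, h, u, ← Complex.exp_nat_mul, ← Complex.exp_add]
    rw [← Complex.exp_zero]
    congr 1
    push_cast
    ring
  have hper : f Real.pi = - f 0 := by
    have : u Real.pi = u 0 := by
      apply Subtype.ext
      simp [u, Complex.exp_two_pi_mul_I]
    simp [f, this, Complex.exp_neg, Complex.exp_pi_mul_I]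
  have hval : ∀ θ, f θ = 1 ∨ f θ = -1 := fun θ => sq_eq_one_iff.1 (hf2 θ)
  have hfin : (Set.range f).Finite :=
    (Set.toFinite {(1 : ℂ), -1}).subset (by rintro _ ⟨θ, rfl⟩; simpa using hval θ)
  have hconst : f Real.pi = f 0 :=
    Set.not_nontrivial_iff.1 (fun hn => (isPreconnected_range hf).infinite_of_nontrivial hn hfin)
      ⟨_, rfl⟩ ⟨_, rfl⟩
  rcases hval 0 with h0 | h0 <;> rw [hper, h0] at hconst <;> norm_num at hconst

/-- A `ZMod 2`-valued Čech cocycle of a cover by preconnected open sets splits if the space is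
simply connected. -/
theorem exists_splitting_of_simplyConnected {B V : Type*} [TopologicalSpace B]
    [SimplyConnectedSpace B] [LocallyPathConnectedSpace B] (O : V → Set B)
    (hO : ∀ v, IsOpen (O v)) (hcov : ∀ x, ∃ v, x ∈ O v) (hconn : ∀ v, IsPreconnected (O v))
    (c : V → V → ZMod 2)
    (hc : ∀ u v w, (O u ∩ O v ∩ O w).Nonempty → c u v + c v w = c u w) :
    ∃ f : V → ZMod 2, ∀ u v, (O u ∩ O v).Nonempty → c u v = f u + f v := by
  classical
  have hc0 : ∀ u, (O u).Nonempty → c u u = 0 := by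
    rintro u ⟨x, hx⟩
    simpa using hc u u u ⟨x, ⟨hx, hx⟩, hx⟩
  -- The cocycle glues a double cover of `B`. Simple connectedness provides a section, which is
  -- constant in the trivialization over each `O v`; these constants are the splitting.
  let Z : FiberBundleCore V B (ZMod 2) :=
    { baseSet := O
      isOpen_baseSet := hO
      indexAt := fun x => (hcov x).choose
      mem_baseSet_at := fun x => (hcov x).choose_spec
      coordChange := fun u v _ ε => ε + c u v
      coordChange_self := fun u x hx ε => by simp [hc0 u ⟨x, hx⟩]
      continuousOn_coordChange := fun u v => by fun_prop
      coordChange_comp := fun u v w x hx ε => by rw [add_assoc, hc u v w ⟨x, hx⟩] }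
  have cov : IsCoveringMap Z.proj := FiberBundle.isCoveringMap (F := ZMod 2) (E := Z.Fiber)
  obtain ⟨x₀⟩ : Nonempty B := inferInstance
  obtain ⟨s, ⟨-, hs⟩, -⟩ := cov.existsUnique_continuousMap_lifts (ContinuousMap.id B) x₀
    (⟨x₀, (0 : ZMod 2)⟩ : Z.TotalSpace) rfl
  have hs' : ∀ x, (s x).proj = x := fun x => congrFun hs x
  let σ : B → ZMod 2 := fun x => (s x).2
  have htriv : ∀ v x, (Z.localTriv v (s x)).2 = σ x + c (Z.indexAt x) v := by
    intro v x
    rw [Z.localTriv_apply]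
    change σ x + c (Z.indexAt (s x).proj) v = _
    rw [hs']
  have hcont : ∀ v, ContinuousOn (fun x => (Z.localTriv v (s x)).2) (O v) := by
    intro v
    refine continuous_snd.comp_continuousOn
      ((Z.localTriv v).continuousOn_toFun.comp s.continuous.continuousOn ?_)
    intro x hx
    rw [Z.mem_localTriv_source]
    change (s x).proj ∈ O v
    rwa [hs']
  have hconst : ∀ v, ∀ x ∈ O v, ∀ y ∈ O v, (Z.localTriv v (s x)).2 = (Z.localTriv v (s y)).2 :=
    fun v x hx y hy => ((hconn v).image _ (hcont v)).subsingleton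
      (Set.mem_image_of_mem _ hx) (Set.mem_image_of_mem _ hy)
  refine ⟨fun v => if h : (O v).Nonempty then (Z.localTriv v (s h.some)).2 else 0, ?_⟩
  rintro u v ⟨x, hxu, hxv⟩
  have hu : (O u).Nonempty := ⟨x, hxu⟩
  have hv : (O v).Nonempty := ⟨x, hxv⟩
  simp only [hu, hv, dif_pos]
  rw [hconst u _ hu.some_mem x hxu, hconst v _ hv.some_mem x hxv, htriv, htriv]
  have h1 := hc (Z.indexAt x) u v ⟨x, ⟨Z.mem_baseSet_at x, hxu⟩, hxv⟩
  rw [← h1]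
  have h2 : ∀ a : ZMod 2, a + a = 0 := CharTwo.add_self_eq_zero
  linear_combination (-1 : ZMod 2) * h2 (σ x) - h2 (c (Z.indexAt x) u)

/-- Square roots on the members of a cover glue if every `ZMod 2`-cocycle of the cover splits. -/
theorem exists_continuous_sqrt_of_cover {B V : Type*} [TopologicalSpace B] (O : V → Set B)
    (hO : ∀ v, IsOpen (O v)) (hcov : ∀ x, ∃ v, x ∈ O v)
    (hconn : ∀ u v, IsPreconnected (O u ∩ O v)) (g : B → ℂ) (hg : ∀ x, g x ≠ 0)
    (hs : ∀ v, ∃ s : B → ℂ, ContinuousOn s (O v) ∧ ∀ x ∈ O v, s x ^ 2 = g x)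
    (hsplit : ∀ c : V → V → ZMod 2,
      (∀ u v w, (O u ∩ O v ∩ O w).Nonempty → c u v + c v w = c u w) →
      ∃ f : V → ZMod 2, ∀ u v, (O u ∩ O v).Nonempty → c u v = f u + f v) :
    ∃ s : B → ℂ, Continuous s ∧ ∀ x, s x ^ 2 = g x := by
  classical
  choose s hsc hs using hs
  have hs0 : ∀ v, ∀ x ∈ O v, s v x ≠ 0 := by
    intro v x hx h0
    exact hg x (by rw [← hs v x hx, h0]; norm_num)
  let e : ZMod 2 → ℂ := fun a => if a = 0 then 1 else -1
  have he : ∀ a b, e (a + b) = e a * e b := by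
    have h01 : ∀ a : ZMod 2, a = 0 ∨ a = 1 := by decide
    have h11 : (1 : ZMod 2) + 1 = 0 := by decide
    intro a b
    rcases h01 a with rfl | rfl <;> rcases h01 b with rfl | rfl <;> simp [e, h11]
  have he2 : ∀ a, e a * e a = 1 := by
    intro a
    rw [← he, CharTwo.add_self_eq_zero]
    simp [e]
  have heinj : Function.Injective e := by
    have h01 : ∀ a : ZMod 2, a = 0 ∨ a = 1 := by decide
    intro a b
    rcases h01 a with rfl | rfl <;> rcases h01 b with rfl | rfl <;> norm_num [e]
  -- Two roots of `g` differ by a sign, constant on the preconnected overlap. These signs form the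
  -- cocycle whose splitting corrects the local roots.
  have hratio : ∀ u v, ∃ a : ZMod 2, ∀ x ∈ O u ∩ O v, s u x = e a * s v x := by
    intro u v
    have hval : ∀ x ∈ O u ∩ O v, s u x / s v x = 1 ∨ s u x / s v x = -1 := by
      rintro x ⟨hu, hv⟩
      apply sq_eq_one_iff.1
      rw [div_pow, hs u x hu, hs v x hv, div_self (hg x)]
    rcases (O u ∩ O v).eq_empty_or_nonempty with hemp | ⟨y, hy⟩
    · exact ⟨0, by simp [hemp]⟩
    have hcts : ContinuousOn (fun x => s u x / s v x) (O u ∩ O v) :=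
      ((hsc u).mono Set.inter_subset_left).div ((hsc v).mono Set.inter_subset_right)
        fun x hx => hs0 v x hx.2
    have hfin : ((fun x => s u x / s v x) '' (O u ∩ O v)).Finite :=
      (Set.toFinite {(1 : ℂ), -1}).subset (by rintro _ ⟨x, hx, rfl⟩; simpa using hval x hx)
    have hconst : ∀ x ∈ O u ∩ O v, s u x / s v x = s u y / s v y := fun x hx =>
      Set.not_nontrivial_iff.1
        (fun hn => ((hconn u v).image _ hcts).infinite_of_nontrivial hn hfin)
        (Set.mem_image_of_mem _ hx) (Set.mem_image_of_mem _ hy)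
    rcases hval y hy with h | h
    · refine ⟨0, fun x hx => ?_⟩
      have := hconst x hx
      rw [h, div_eq_iff (hs0 v x hx.2)] at this
      simpa [e] using this
    · refine ⟨1, fun x hx => ?_⟩
      have := hconst x hx
      rw [h, div_eq_iff (hs0 v x hx.2)] at this
      simpa [e] using this
  choose c hc using hratio
  obtain ⟨f, hf⟩ := hsplit c (by
    rintro u v w ⟨x, ⟨hu, hv⟩, hw⟩
    apply heinj
    apply mul_right_cancel₀ (hs0 w x hw)
    rw [he, mul_assoc, ← hc v w x ⟨hv, hw⟩, ← hc u v x ⟨hu, hv⟩, ← hc u w x ⟨hu, hw⟩])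
  let t : V → B → ℂ := fun v x => e (f v) * s v x
  have ht : ∀ u v x, x ∈ O u → x ∈ O v → t u x = t v x := by
    intro u v x hu hv
    simp only [t]
    rw [hc u v x ⟨hu, hv⟩, hf u v ⟨x, hu, hv⟩, he]
    linear_combination (e (f v) * s v x) * he2 (f u)
  let r : B → ℂ := fun x => t (hcov x).choose x
  have hr : ∀ v, ∀ x ∈ O v, r x = t v x := fun v x hx => ht _ _ _ (hcov x).choose_spec hx
  refine ⟨r, ?_, fun x => ?_⟩
  · rw [continuous_iff_continuousAt]
    intro x
    obtain ⟨v, hv⟩ := hcov x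
    have hn := (hO v).mem_nhds hv
    have h1 : ContinuousAt (t v) x := (continuousOn_const.mul (hsc v)).continuousAt hn
    exact h1.congr (by filter_upwards [hn] with y hy using (hr v y hy).symm)
  · obtain ⟨v, hv⟩ := hcov x
    rw [hr v x hv, mul_pow, hs v x hv, sq, he2, one_mul]

/-! ### The cover of a punctured realization by punctured stars -/

namespace AbstractSimplicialComplex

variable {V : Type*} [Fintype V] [DecidableEq V]

/-- The geometric realization of an abstract simplicial complex, in barycentric coordinates. -/
def realization (K : AbstractSimplicialComplex V) : Set (V → ℝ) :=
  {y | (∀ v, 0 ≤ y v) ∧ ∑ v, y v = 1 ∧ ∃ s ∈ K.faces, ∀ v, y v ≠ 0 → v ∈ s}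

/-- The barycenter of a finite set of vertices. -/
noncomputable def barycenter (s : Finset V) : V → ℝ := fun v => if v ∈ s then (s.card : ℝ)⁻¹ else 0

/-- The faces of `K` that contain no member of `P`. -/
def facesAvoiding (K : AbstractSimplicialComplex V) (P : Set (Finset V)) : Set (Finset V) :=
  {s | s ∈ K.faces ∧ ∀ σ ∈ P, ¬ σ ⊆ s}

/-- The open star of the vertex `v`, made smaller so that it omits the barycenters of the members
of `P`. -/
def puncturedStar (K : AbstractSimplicialComplex V) (P : Set (Finset V)) (v : V) : Set (V → ℝ) :=
  {y ∈ K.realization | 0 < y v ∧ ∀ σ ∈ P, v ∈ σ → ∃ u ∈ σ, y u < y v}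

variable {K : AbstractSimplicialComplex V} {P : Set (Finset V)}

theorem barycenter_mem_realization {s : Finset V} (hs : s ∈ K.faces) :
    barycenter s ∈ K.realization := by
  have hne : s.Nonempty := (K.isRelLowerSet_faces hs).1
  have hc : (s.card : ℝ) ≠ 0 := by exact_mod_cast hne.card_pos.ne'
  refine ⟨fun v => ?_, ?_, s, hs, fun v hv => ?_⟩
  · unfold barycenter
    split_ifs <;> positivity
  · simp [barycenter, Finset.sum_ite_mem, hc]
  · by_contra h
    simp [barycenter, h] at hv

/-- A vertex of `σ` where `y` is minimal cannot lie in `s`, since its own punctured star would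
demand a smaller coordinate on `σ`. Hence `s` never contains `σ`, and one `u` outside `s` serves as
a witness that survives moving towards the barycenter of `s`. -/
theorem exists_lt_of_mem_puncturedStar {s σ : Finset V} {y : V → ℝ} (hσ : σ ∈ P)
    (hy : ∀ v ∈ s, y ∈ K.puncturedStar P v) {v : V} (hv : v ∈ s) (hvσ : v ∈ σ) :
    ∃ u ∈ σ, u ∉ s ∧ y u < y v := by
  obtain ⟨u, hu, hmin⟩ := σ.exists_min_image y ⟨v, hvσ⟩
  obtain ⟨u', hu', hlt⟩ := (hy v hv).2.2 σ hσ hvσ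
  refine ⟨u, hu, fun hus => ?_, (hmin u' hu').trans_lt hlt⟩
  obtain ⟨w, hw, hwu⟩ := (hy u hus).2.2 σ hσ hu
  exact absurd (hmin w hw) (not_le.2 hwu)

/-- Only the faces avoiding `P` give nonempty intersections of punctured stars. -/
theorem mem_facesAvoiding_of_mem_puncturedStar (hP : ∀ σ ∈ P, σ.Nonempty) {s : Finset V}
    (hs : s.Nonempty) {y : V → ℝ} (hy : ∀ v ∈ s, y ∈ K.puncturedStar P v) :
    s ∈ K.facesAvoiding P := by
  obtain ⟨v, hv⟩ := hs
  obtain ⟨-, -, t, ht, hyt⟩ := (hy v hv).1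
  refine ⟨(K.isRelLowerSet_faces ht).2 (fun w hw => hyt w (hy w hw).2.1.ne') ⟨v, hv⟩, ?_⟩
  intro σ hσ hσs
  obtain ⟨w, hw⟩ := hP σ hσ
  obtain ⟨u, hu, hus, -⟩ := exists_lt_of_mem_puncturedStar hσ hy (hσs hw) hw
  exact hus (hσs hu)

theorem barycenter_mem_puncturedStar {s : Finset V} (hs : s ∈ K.facesAvoiding P) {v : V}
    (hv : v ∈ s) : barycenter s ∈ K.puncturedStar P v := by
  have hc : (0 : ℝ) < (s.card : ℝ)⁻¹ := by
    have := Finset.card_pos.2 ⟨v, hv⟩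
    positivity
  refine ⟨barycenter_mem_realization hs.1, by simpa [barycenter, hv] using hc, fun σ hσ _ => ?_⟩
  obtain ⟨u, hu, hus⟩ := Finset.not_subset.1 (hs.2 σ hσ)
  exact ⟨u, hu, by simpa [barycenter, hv, hus] using hc⟩

/-- Moving towards the barycenter of `s` adds weight only on `s`, and the witness `u` for the strict
inequality can be chosen outside `s`. -/
theorem starConvex_iInter_puncturedStar {s : Finset V} (hs : s ∈ K.facesAvoiding P) :
    StarConvex ℝ (barycenter s) {y | ∀ v ∈ s, y ∈ K.puncturedStar P v} := by
  intro y hy a b ha hb hab v hv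
  have hc : ∀ w ∈ s, 0 < barycenter s w := fun w hw =>
    (barycenter_mem_puncturedStar hs hw).2.1
  have hb0 := barycenter_mem_realization hs.1
  obtain ⟨hy0, hy1, t, ht, hyt⟩ := (hy v hv).1
  have hpos : ∀ w ∈ s, 0 < a * barycenter s w + b * y w := by
    intro w hw
    rcases ha.eq_or_lt with rfl | ha
    · have hb1 : b = 1 := by linarith
      simpa [hb1] using (hy w hw).2.1
    · have := mul_pos ha (hc w hw)
      have := mul_nonneg hb (hy0 w)
      linarith
  refine ⟨⟨fun w => ?_, ?_, t, ht, fun w hw => ?_⟩, ?_, fun σ hσ hvσ => ?_⟩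
  · exact add_nonneg (mul_nonneg ha (hb0.1 w)) (mul_nonneg hb (hy0 w))
  · simp only [Pi.add_apply, Pi.smul_apply, smul_eq_mul, Finset.sum_add_distrib, ← Finset.mul_sum,
      hb0.2.1, hy1, mul_one, hab]
  · by_cases hws : w ∈ s
    · exact hyt w (hy w hws).2.1.ne'
    · apply hyt
      rintro h0
      simp [barycenter, hws, h0] at hw
  · exact hpos v hv
  · obtain ⟨u, hu, hus, hlt⟩ := exists_lt_of_mem_puncturedStar hσ hy hv hvσ
    refine ⟨u, hu, ?_⟩
    simp only [Pi.add_apply, Pi.smul_apply, smul_eq_mul]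
    rcases ha.eq_or_lt with rfl | ha
    · have hb1 : b = 1 := by linarith
      simpa [hb1] using hlt
    · have h1 := mul_pos ha (hc v hv)
      have h2 := mul_le_mul_of_nonneg_left hlt.le hb
      have h3 : barycenter s u = 0 := by simp [barycenter, hus]
      rw [h3]
      linarith

theorem puncturedStar_isOpen (v : V) :
    ∃ O : Set (V → ℝ), IsOpen O ∧ K.puncturedStar P v = K.realization ∩ O := by
  refine ⟨{y | 0 < y v} ∩ ⋂ σ ∈ {σ : Finset V | σ ∈ P ∧ v ∈ σ}, ⋃ u ∈ {u | u ∈ σ}, {y | y u < y v},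
    ?_, ?_⟩
  · refine (isOpen_lt continuous_const (continuous_apply v)).inter
      ((Set.toFinite _).isOpen_biInter fun σ _ => isOpen_biUnion fun u _ =>
        isOpen_lt (continuous_apply u) (continuous_apply v))
  · ext y
    simp [puncturedStar]
    tauto

theorem barycenter_notMem_puncturedStar {σ : Finset V} (hσ : σ ∈ P) (v : V) :
    barycenter σ ∉ K.puncturedStar P v := by
  rintro ⟨-, hpos, h⟩
  have hv : v ∈ σ := by
    by_contra hv
    simp [barycenter, hv] at hpos
  obtain ⟨u, hu, hlt⟩ := h σ hσ hv
  simp [barycenter, hu, hv] at hlt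

/-- If every face contains at most one member of `P`, the punctured stars cover everything but
the barycenters of members of `P`. -/
theorem exists_mem_puncturedStar
    (hP : ∀ s ∈ K.faces, ∀ σ ∈ P, ∀ τ ∈ P, σ ⊆ s → τ ⊆ s → σ = τ)
    {y : V → ℝ} (hy : y ∈ K.realization) (hne : ∀ σ ∈ P, y ≠ barycenter σ) :
    ∃ v, y ∈ K.puncturedStar P v := by
  by_contra! hcon
  obtain ⟨hy0, hy1, t, ht, hyt⟩ := hy
  -- If no star contains `y`, every vertex of its support minimizes `y` on some member of `P`. That
  -- member lies in the carrier `t`, so it is always the same `σ`; hence `y` is constant on `σ` and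
  -- zero off it.
  have key : ∀ v, 0 < y v → ∃ σ ∈ P, v ∈ σ ∧ ∀ u ∈ σ, y v ≤ y u := by
    intro v hv
    by_contra! h
    exact hcon v ⟨⟨hy0, hy1, t, ht, hyt⟩, hv, h⟩
  have hsub : ∀ σ : Finset V, ∀ v, 0 < y v → (∀ u ∈ σ, y v ≤ y u) → σ ⊆ t := fun σ v hv h u hu =>
    hyt u (hv.trans_le (h u hu)).ne'
  obtain ⟨v, -, hv⟩ : ∃ v ∈ Finset.univ, 0 < y v :=
    (Finset.sum_pos_iff_of_nonneg fun v _ => hy0 v).1 (by rw [hy1]; exact one_pos)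
  obtain ⟨σ, hσ, hvσ, hmin⟩ := key v hv
  have hall : ∀ w, 0 < y w → w ∈ σ ∧ ∀ u ∈ σ, y w ≤ y u := by
    intro w hw
    obtain ⟨τ, hτ, hwτ, hmin'⟩ := key w hw
    obtain rfl := hP t ht σ hσ τ hτ (hsub σ v hv hmin) (hsub τ w hw hmin')
    exact ⟨hwτ, hmin'⟩
  have hpos : ∀ u ∈ σ, 0 < y u := fun u hu => hv.trans_le (hmin u hu)
  have hconst : ∀ u ∈ σ, y u = y v := fun u hu =>
    le_antisymm ((hall u (hpos u hu)).2 v hvσ) (hmin u hu)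
  have hzero : ∀ u, u ∉ σ → y u = 0 := fun u hu =>
    le_antisymm (not_lt.1 fun h => hu (hall u h).1) (hy0 u)
  have hsum : (σ.card : ℝ) * y v = 1 := by
    rw [← hy1, ← Finset.sum_subset σ.subset_univ fun u _ hu => hzero u hu,
      Finset.sum_congr rfl hconst, Finset.sum_const, nsmul_eq_mul]
  apply hne σ hσ
  ext u
  by_cases hu : u ∈ σ
  · rw [hconst u hu]
    simp only [barycenter, hu, if_true]
    exact eq_inv_of_mul_eq_one_right hsum
  · simp [barycenter, hu, hzero u hu]

/-! ### Cohomology of punctured realizations -/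

/-- Removing any point from `X` leaves a topological plane. -/
def PuncturesArePlanes {E : Type*} [TopologicalSpace E] (X : Set E) : Prop :=
  ∀ x ∈ X, Nonempty ({y // y ∈ X ∧ y ≠ x} ≃ₜ ℂ)

/-- A `ZMod 2`-valued 1-cocycle on a family of faces, as a function of ordered pairs. -/
def IsCocycleOn (D : Set (Finset V)) (c : V → V → ZMod 2) : Prop :=
  ∀ u v w, {u, v, w} ∈ D → c u v + c v w = c u w

/-- A `ZMod 2`-valued 1-coboundary on a family of faces. -/
def IsCoboundaryOn (D : Set (Finset V)) (c : V → V → ZMod 2) : Prop :=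
  ∃ f : V → ZMod 2, ∀ u v, {u, v} ∈ D → c u v = f u + f v

/-- The realization without the barycenters of the members of `P`. -/
abbrev PuncturedRealization (K : AbstractSimplicialComplex V) (P : Set (Finset V)) : Type _ :=
  {y : V → ℝ // y ∈ K.realization ∧ ∀ σ ∈ P, y ≠ barycenter σ}

/-- The punctured stars as subsets of the punctured realization. -/
def puncturedStarIn (K : AbstractSimplicialComplex V) (P : Set (Finset V)) (v : V) :
    Set (K.PuncturedRealization P) :=
  {y | y.1 ∈ K.puncturedStar P v}

theorem isOpen_puncturedStarIn (v : V) : IsOpen (K.puncturedStarIn P v) := by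
  obtain ⟨O, hO, h⟩ := K.puncturedStar_isOpen (P := P) v
  have : K.puncturedStarIn P v = Subtype.val ⁻¹' O := by
    ext y
    simp [puncturedStarIn, h, y.2.1]
  rw [this]
  exact hO.preimage continuous_subtype_val

/-- The intersection is star-convex about the barycenter of `s` if `s` avoids `P`, and empty
otherwise. -/
theorem isPreconnected_setOf_puncturedStarIn (hP : ∀ σ ∈ P, σ.Nonempty) {s : Finset V}
    (hs : s.Nonempty) :
    IsPreconnected {y | ∀ v ∈ s, y ∈ K.puncturedStarIn P v} := by
  have hind : Topology.IsInducing (Subtype.val : K.PuncturedRealization P → V → ℝ) := ⟨rfl⟩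
  rw [← hind.isPreconnected_image]
  have : Subtype.val '' {y | ∀ v ∈ s, y ∈ K.puncturedStarIn P v} =
      {y | ∀ v ∈ s, y ∈ K.puncturedStar P v} := by
    ext y
    constructor
    · rintro ⟨y, hy, rfl⟩
      exact hy
    · intro hy
      obtain ⟨v, hv⟩ := hs
      refine ⟨⟨y, (hy v hv).1, fun σ hσ h => ?_⟩, hy, rfl⟩
      exact barycenter_notMem_puncturedStar hσ v (h ▸ hy v hv)
  rw [this]
  by_cases hD : s ∈ K.facesAvoiding P
  · exact ((starConvex_iInter_puncturedStar hD).isPathConnected fun v hv =>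
      barycenter_mem_puncturedStar hD hv).isConnected.isPreconnected
  · convert isPreconnected_empty
    ext y
    simp only [Set.mem_ofPred_eq, Set.mem_empty_iff_false, iff_false]
    exact fun hy => hD (mem_facesAvoiding_of_mem_puncturedStar hP hs hy)

theorem isPreconnected_puncturedStarIn (hP : ∀ σ ∈ P, σ.Nonempty) (v : V) :
    IsPreconnected (K.puncturedStarIn P v) := by
  simpa using isPreconnected_setOf_puncturedStarIn hP (K := K) (Finset.singleton_nonempty v)

theorem isPreconnected_puncturedStarIn_inter (hP : ∀ σ ∈ P, σ.Nonempty) (u v : V) :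
    IsPreconnected (K.puncturedStarIn P u ∩ K.puncturedStarIn P v) := by
  have := isPreconnected_setOf_puncturedStarIn hP (K := K) (Finset.insert_nonempty u {v})
  convert this using 1
  ext y
  simp

/-- Together with the triple version, this identifies the part of the nerve that 1-cocycles and
1-coboundaries see. -/
theorem puncturedStarIn_inter_nonempty (hP : ∀ σ ∈ P, σ.Nonempty) (u v : V) :
    (K.puncturedStarIn P u ∩ K.puncturedStarIn P v).Nonempty ↔ {u, v} ∈ K.facesAvoiding P := by
  constructor
  · rintro ⟨y, hu, hv⟩
    refine mem_facesAvoiding_of_mem_puncturedStar hP (Finset.insert_nonempty _ _) (y := y.1) ?_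
    simpa using ⟨hu, hv⟩
  · intro h
    have hu := barycenter_mem_puncturedStar h (v := u) (by simp)
    have hv := barycenter_mem_puncturedStar h (v := v) (by simp)
    exact ⟨⟨_, hu.1, fun σ hσ h' => barycenter_notMem_puncturedStar hσ u (h' ▸ hu)⟩, hu, hv⟩

theorem puncturedStarIn_inter_inter_nonempty (hP : ∀ σ ∈ P, σ.Nonempty) (u v w : V) :
    (K.puncturedStarIn P u ∩ K.puncturedStarIn P v ∩ K.puncturedStarIn P w).Nonempty ↔
      {u, v, w} ∈ K.facesAvoiding P := by
  constructor
  · rintro ⟨y, ⟨hu, hv⟩, hw⟩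
    refine mem_facesAvoiding_of_mem_puncturedStar hP (Finset.insert_nonempty _ _) (y := y.1) ?_
    simpa using ⟨hu, hv, hw⟩
  · intro h
    have hu := barycenter_mem_puncturedStar h (v := u) (by simp)
    have hv := barycenter_mem_puncturedStar h (v := v) (by simp)
    have hw := barycenter_mem_puncturedStar h (v := w) (by simp)
    exact ⟨⟨_, hu.1, fun σ hσ h' => barycenter_notMem_puncturedStar hσ u (h' ▸ hu)⟩, ⟨hu, hv⟩, hw⟩

theorem exists_mem_puncturedStarIn
    (hP : ∀ s ∈ K.faces, ∀ σ ∈ P, ∀ τ ∈ P, σ ⊆ s → τ ⊆ s → σ = τ)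
    (y : K.PuncturedRealization P) : ∃ v, y ∈ K.puncturedStarIn P v :=
  exists_mem_puncturedStar hP y.2.1 y.2.2

theorem puncturesArePlanes_single (hX : PuncturesArePlanes K.realization) {σ : Finset V}
    (hσ : σ ∈ K.faces) : Nonempty (K.PuncturedRealization {σ} ≃ₜ ℂ) := by
  obtain ⟨φ⟩ := hX _ (barycenter_mem_realization hσ)
  exact ⟨(Homeomorph.setCongr (by ext; simp)).trans φ⟩

/-- The edge graph of the faces avoiding `σ` is connected. -/
theorem eq_of_facesAvoiding_single (hX : PuncturesArePlanes K.realization) {σ : Finset V}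
    (hσ : σ ∈ K.faces) {α : Type*} (f : V → α)
    (hf : ∀ u v, {u, v} ∈ K.facesAvoiding {σ} → f u = f v) {u v : V}
    (hu : {u} ∈ K.facesAvoiding {σ}) (hv : {v} ∈ K.facesAvoiding {σ}) : f u = f v := by
  have hP : ∀ ρ ∈ ({σ} : Set (Finset V)), ρ.Nonempty := by
    rintro _ rfl
    exact (K.isRelLowerSet_faces hσ).1
  obtain ⟨φ⟩ := puncturesArePlanes_single hX hσ
  have hpre : PreconnectedSpace (K.PuncturedRealization {σ}) :=
    φ.symm.surjective.denseRange.preconnectedSpace φ.symm.continuous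
  have hcov := exists_mem_puncturedStarIn (K := K) (P := {σ}) (by
    rintro s - _ rfl _ rfl - -
    rfl)
  choose i hi using hcov
  have hi' : ∀ v, ∀ y ∈ K.puncturedStarIn {σ} v, f (i y) = f v := fun v y hy =>
    hf _ _ ((puncturedStarIn_inter_nonempty hP _ _).1 ⟨y, hi y, hy⟩)
  have hloc : IsLocallyConstant fun y => f (i y) := by
    rw [IsLocallyConstant.iff_exists_open]
    exact fun y => ⟨_, isOpen_puncturedStarIn (i y), hi y, fun z hz => hi' _ z hz⟩
  have hne : ∀ w, {w} ∈ K.facesAvoiding {σ} → ∃ y, y ∈ K.puncturedStarIn {σ} w := by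
    intro w hw
    obtain ⟨y, hy, -⟩ := (puncturedStarIn_inter_nonempty hP w w).2 (by simpa using hw)
    exact ⟨y, hy⟩
  obtain ⟨y, hy⟩ := hne u hu
  obtain ⟨z, hz⟩ := hne v hv
  rw [← hi' u y hy, ← hi' v z hz]
  exact hloc.apply_eq_of_preconnectedSpace _ _

/-- The faces avoiding `σ` have trivial first cohomology. -/
theorem isCoboundaryOn_facesAvoiding_single (hX : PuncturesArePlanes K.realization)
    {σ : Finset V} (hσ : σ ∈ K.faces) {c : V → V → ZMod 2}
    (hc : IsCocycleOn (K.facesAvoiding {σ}) c) : IsCoboundaryOn (K.facesAvoiding {σ}) c := by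
  have hP : ∀ ρ ∈ ({σ} : Set (Finset V)), ρ.Nonempty := by
    rintro _ rfl
    exact (K.isRelLowerSet_faces hσ).1
  obtain ⟨φ⟩ := puncturesArePlanes_single hX hσ
  have := φ.toHomotopyEquiv.simplyConnectedSpace
  have := φ.isOpenEmbedding.locallyPathConnectedSpace
  obtain ⟨f, hf⟩ := exists_splitting_of_simplyConnected (K.puncturedStarIn {σ})
    isOpen_puncturedStarIn (exists_mem_puncturedStarIn (by
      rintro s - _ rfl _ rfl - -
      rfl)) (isPreconnected_puncturedStarIn hP) c
    fun u v w h => hc u v w ((puncturedStarIn_inter_inter_nonempty hP u v w).1 h)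
  exact ⟨f, fun u v h => hf u v ((puncturedStarIn_inter_nonempty hP u v).2 h)⟩

/-- A nowhere vanishing function without square root on the realization with two punctures. -/
theorem exists_no_sqrt (hX : PuncturesArePlanes K.realization) {σ τ : Finset V}
    (hσ : σ ∈ K.faces) (hτ : τ ∈ K.faces) (hne : σ ≠ τ) :
    ∃ g : C(K.PuncturedRealization {σ, τ}, ℂ), (∀ y, g y ≠ 0) ∧
      ¬ ∃ s : K.PuncturedRealization {σ, τ} → ℂ, Continuous s ∧ ∀ y, s y ^ 2 = g y := by
  obtain ⟨φ⟩ := hX _ (barycenter_mem_realization hσ)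
  have hb : barycenter τ ≠ barycenter σ := by
    intro h
    apply hne
    have hmem : ∀ ρ ∈ K.faces, ∀ v, v ∈ ρ ↔ barycenter ρ v ≠ 0 := by
      intro ρ hρ v
      have hc := (K.isRelLowerSet_faces hρ).1.card_pos.ne'
      simp [barycenter]
      rintro - rfl
      simp at hc
    ext v
    rw [hmem σ hσ, hmem τ hτ, h]
  let b : {y // y ∈ K.realization ∧ y ≠ barycenter σ} := ⟨_, barycenter_mem_realization hτ, hb⟩
  let j : K.PuncturedRealization {σ, τ} → {y // y ∈ K.realization ∧ y ≠ barycenter σ} :=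
    fun y => ⟨y.1, y.2.1, y.2.2 σ (by simp)⟩
  have hj : Continuous j := by fun_prop
  -- In the plane left by the first puncture, this is the coordinate centred at the second. Along
  -- `k` below it becomes the identity of the punctured plane.
  refine ⟨⟨fun y => φ (j y) - φ b, by fun_prop⟩, fun y h => ?_, ?_⟩
  · have := φ.injective (sub_eq_zero.1 h)
    exact y.2.2 τ (by simp) (congrArg Subtype.val this)
  · rintro ⟨s, hs, hsq⟩
    apply not_exists_continuous_sqrt_punctured_plane
    let k : {z : ℂ // z ≠ 0} → K.PuncturedRealization {σ, τ} := fun z =>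
      ⟨φ.symm (z + φ b), (φ.symm (z + φ b)).2.1, by
        rintro ρ (rfl | rfl)
        · exact (φ.symm (z + φ b)).2.2
        · intro h
          have h1 : φ.symm (z + φ b) = b := Subtype.ext h
          have h2 := congrArg φ h1
          simp [z.2] at h2⟩
    have hk : Continuous k := by fun_prop
    refine ⟨s ∘ k, hs.comp hk, fun z => ?_⟩
    rw [Function.comp_apply, hsq]
    change φ (φ.symm (z + φ b)) - φ b = z
    simp

/-- The faces avoiding two separated faces have nontrivial first cohomology. -/
theorem exists_not_isCoboundaryOn_facesAvoiding_pair (hX : PuncturesArePlanes K.realization)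
    {σ τ : Finset V} (hσ : σ ∈ K.faces) (hτ : τ ∈ K.faces) (hne : σ ≠ τ)
    (hsep : ∀ s ∈ K.faces, σ ⊆ s → ¬ τ ⊆ s) :
    ∃ c, IsCocycleOn (K.facesAvoiding {σ, τ}) c ∧ ¬ IsCoboundaryOn (K.facesAvoiding {σ, τ}) c := by
  have hP : ∀ ρ ∈ ({σ, τ} : Set (Finset V)), ρ.Nonempty := by
    rintro _ (rfl | rfl)
    exacts [(K.isRelLowerSet_faces hσ).1, (K.isRelLowerSet_faces hτ).1]
  obtain ⟨g, hg, hno⟩ := exists_no_sqrt hX hσ hτ hne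
  by_contra! hcon
  apply hno
  -- Were every cocycle a coboundary, the roots of `g` on the contractible punctured stars would
  -- glue to a global root.
  refine exists_continuous_sqrt_of_cover (K.puncturedStarIn {σ, τ}) isOpen_puncturedStarIn
    (exists_mem_puncturedStarIn ?_) (isPreconnected_puncturedStarIn_inter hP) g hg
    (fun v => ?_) fun c hc => ?_
  · rintro s hs _ (rfl | rfl) _ (rfl | rfl) h1 h2
    exacts [rfl, (hsep s hs h1 h2).elim, (hsep s hs h2 h1).elim, rfl]
  · by_cases hv : {v} ∈ K.facesAvoiding {σ, τ}
    · have hstar := starConvex_iInter_puncturedStar hv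
      simp only [Finset.mem_singleton, forall_eq, Set.ofPred_mem_eq] at hstar
      have : ContractibleSpace (K.puncturedStar {σ, τ} v) := hstar.contractibleSpace
        ⟨_, barycenter_mem_puncturedStar hv (Finset.mem_singleton_self v)⟩
      have hmem : ∀ y ∈ K.puncturedStar {σ, τ} v, ∀ ρ ∈ ({σ, τ} : Set (Finset V)),
          y ≠ barycenter ρ := by
        rintro y hy ρ hρ rfl
        exact barycenter_notMem_puncturedStar hρ v hy
      let j : C(K.puncturedStar {σ, τ} v, K.PuncturedRealization {σ, τ}) :=
        ⟨fun y => ⟨y.1, y.2.1, hmem y.1 y.2⟩, by fun_prop⟩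
      obtain ⟨s, hs⟩ := exists_continuous_sqrt_of_contractible (g.comp j) fun y => hg _
      classical
      refine ⟨fun y => if h : y.1 ∈ K.puncturedStar {σ, τ} v then s ⟨y.1, h⟩ else 0, ?_, ?_⟩
      · rw [continuousOn_iff_continuous_domRestrict]
        have : (K.puncturedStarIn {σ, τ} v).domRestrict (fun y : K.PuncturedRealization {σ, τ} =>
            if h : y.1 ∈ K.puncturedStar {σ, τ} v then s ⟨y.1, h⟩ else 0) =
            fun y => s ⟨y.1.1, y.2⟩ := by
          ext y
          have hy : y.1.1 ∈ K.puncturedStar {σ, τ} v := y.2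
          exact dif_pos hy
        rw [this]
        fun_prop
      · intro y hy
        have hy' : y.1 ∈ K.puncturedStar {σ, τ} v := hy
        simp only [dif_pos hy']
        exact hs ⟨y.1, hy'⟩
    · have : K.puncturedStarIn {σ, τ} v = ∅ := by
        rw [← Set.not_nonempty_iff_eq_empty]
        rintro ⟨y, hy⟩
        exact hv (by simpa using (puncturedStarIn_inter_nonempty hP v v).1 ⟨y, hy, hy⟩)
      exact ⟨0, by simp [this]⟩
  · obtain ⟨f, hf⟩ := hcon c fun u v w h =>
      hc u v w ((puncturedStarIn_inter_inter_nonempty hP u v w).2 h)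
    exact ⟨f, fun u v h => hf u v ((puncturedStarIn_inter_nonempty hP u v).1 h)⟩

/-- A full simplex is not a sphere. -/
theorem univ_notMem_faces (hX : PuncturesArePlanes K.realization) {v w : V} (hvw : v ≠ w) :
    Finset.univ ∉ K.faces := by
  intro hK
  obtain ⟨g, hg, hno⟩ := exists_no_sqrt hX (K.singleton_mem v) (K.singleton_mem w)
    (by simpa using hvw)
  apply hno
  have hvert : ∀ u : V, ∀ y ∈ K.realization, y ≠ barycenter {u} ↔ ∃ x, x ≠ u ∧ 0 < y x := by
    rintro u y ⟨hy0, hy1, -⟩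
    constructor
    · intro h
      by_contra! hcon
      apply h
      have hz : ∀ x, x ≠ u → y x = 0 := fun x hx => le_antisymm (hcon x hx) (hy0 x)
      rw [Fintype.sum_eq_single u hz] at hy1
      ext x
      by_cases hx : x = u
      · simp [barycenter, hx, hy1]
      · simp [barycenter, hx, hz x hx]
    · rintro ⟨x, hx, hpos⟩ rfl
      simp [barycenter, hx] at hpos
  have hbu := barycenter_mem_realization hK
  have hbpos : ∀ x : V, 0 < barycenter Finset.univ x := by
    intro x
    have : 0 < (Finset.univ : Finset V).card := Finset.card_pos.2 ⟨x, by simp⟩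
    simp only [barycenter, Finset.mem_univ, if_true]
    positivity
  -- A full simplex without two of its vertices is star-shaped about its barycenter, hence
  -- contractible, and `g` would have a root.
  have hstar : StarConvex ℝ (barycenter Finset.univ)
      {y : V → ℝ | y ∈ K.realization ∧ ∀ σ ∈ ({{v}, {w}} : Set (Finset V)), y ≠ barycenter σ} := by
    rintro y ⟨hy, hyP⟩ a b ha hb hab
    have hmem : a • barycenter Finset.univ + b • y ∈ K.realization := by
      refine ⟨fun u => ?_, ?_, Finset.univ, hK, by simp⟩
      · exact add_nonneg (mul_nonneg ha (hbu.1 u)) (mul_nonneg hb (hy.1 u))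
      · simp only [Pi.add_apply, Pi.smul_apply, smul_eq_mul, Finset.sum_add_distrib,
          ← Finset.mul_sum, hbu.2.1, hy.2.1, mul_one, hab]
    have hne : ∀ u, y ≠ barycenter {u} → a • barycenter Finset.univ + b • y ≠ barycenter {u} := by
      intro u hu
      obtain ⟨x, hx, hpos⟩ := (hvert u y hy).1 hu
      refine (hvert u _ hmem).2 ⟨x, hx, ?_⟩
      simp only [Pi.add_apply, Pi.smul_apply, smul_eq_mul]
      have h1 := mul_nonneg ha (hbpos x).le
      have h2 := mul_nonneg hb hpos.le
      rcases ha.eq_or_lt with rfl | ha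
      · have hb1 : b = 1 := by linarith
        simpa [hb1] using hpos
      · have := mul_pos ha (hbpos x)
        linarith
    refine ⟨hmem, ?_⟩
    rintro _ (rfl | rfl)
    exacts [hne v (hyP _ (by simp)), hne w (hyP _ (by simp))]
  have hmemb : ∀ σ ∈ ({{v}, {w}} : Set (Finset V)), barycenter Finset.univ ≠ barycenter σ := by
    rintro _ (rfl | rfl)
    · exact (hvert v _ hbu).2 ⟨w, hvw.symm, hbpos w⟩
    · exact (hvert w _ hbu).2 ⟨v, hvw, hbpos v⟩
  have : ContractibleSpace (K.PuncturedRealization {{v}, {w}}) :=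
    hstar.contractibleSpace ⟨_, hbu, hmemb⟩
  obtain ⟨s, hs⟩ := exists_continuous_sqrt_of_contractible g hg
  exact ⟨s, s.continuous, hs⟩

end AbstractSimplicialComplex

/-! ### From geometric complexes to barycentric realizations -/

theorem puncturesArePlanes_sphere :
    AbstractSimplicialComplex.PuncturesArePlanes
      (Metric.sphere (0 : EuclideanSpace ℝ (Fin 3)) 1) := by
  intro x hx
  have : Fact (Module.finrank ℝ (EuclideanSpace ℝ (Fin 3)) = 2 + 1) := ⟨by simp⟩
  let φ := stereographic' 2 (⟨x, hx⟩ : Metric.sphere (0 : EuclideanSpace ℝ (Fin 3)) 1)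
  have h1 : {y // y ∈ Metric.sphere (0 : EuclideanSpace ℝ (Fin 3)) 1 ∧ y ≠ x} ≃ₜ φ.source :=
    { toFun := fun y => ⟨⟨y.1, y.2.1⟩, by
        simp only [φ, stereographic'_source, Set.mem_compl_iff, Set.mem_singleton_iff]
        exact fun h => y.2.2 (congrArg Subtype.val h)⟩
      invFun := fun y => ⟨y.1.1, y.1.2, fun h => by
        have h2 : y.1 ∈ φ.source := y.2
        simp only [φ, stereographic'_source, Set.mem_compl_iff, Set.mem_singleton_iff] at h2
        exact h2 (Subtype.ext h)⟩
      left_inv := fun y => rfl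
      right_inv := fun y => rfl
      continuous_toFun := by fun_prop
      continuous_invFun := by fun_prop }
  have h2 : φ.target ≃ₜ EuclideanSpace ℝ (Fin 2) :=
    (Homeomorph.setCongr (stereographic'_target _)).trans (Homeomorph.Set.univ _)
  exact ⟨(h1.trans φ.toHomeomorphSourceTarget).trans
    (h2.trans Complex.orthonormalBasisOneI.repr.symm.toHomeomorph)⟩

theorem AbstractSimplicialComplex.PuncturesArePlanes.of_homeomorph {E F : Type*}
    [TopologicalSpace E] [TopologicalSpace F] {X : Set E} {Y : Set F}
    (hY : PuncturesArePlanes Y) (e : X ≃ₜ Y) : PuncturesArePlanes X := by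
  intro x hx
  obtain ⟨φ⟩ := hY (e ⟨x, hx⟩) (e ⟨x, hx⟩).2
  refine ⟨Homeomorph.trans ?_ φ⟩
  exact
    { toFun := fun y => ⟨e ⟨y.1, y.2.1⟩, (e ⟨y.1, y.2.1⟩).2, fun h =>
        y.2.2 (congrArg Subtype.val (e.injective (Subtype.ext h)))⟩
      invFun := fun y => ⟨e.symm ⟨y.1, y.2.1⟩, (e.symm ⟨y.1, y.2.1⟩).2, fun h =>
        y.2.2 (by
          have h2 : e.symm ⟨y.1, y.2.1⟩ = ⟨x, hx⟩ := Subtype.ext h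
          exact congrArg Subtype.val ((e.symm_apply_eq).1 h2))⟩
      left_inv := fun y => by simp
      right_inv := fun y => by simp
      continuous_toFun := by fun_prop
      continuous_invFun := by fun_prop }

theorem AbstractSimplicialComplex.isCompact_realization {V : Type*} [Fintype V]
    (K : AbstractSimplicialComplex V) : IsCompact K.realization := by
  have : K.realization =
      stdSimplex ℝ V ∩ ⋃ s ∈ K.faces, ⋂ v ∈ {v | v ∉ s}, {y : V → ℝ | y v = 0} := by
    ext y
    simp only [realization, stdSimplex, Set.mem_ofPred_eq, Set.mem_inter_iff, Set.mem_iUnion,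
      Set.mem_iInter, exists_prop, and_assoc]
    refine and_congr_right fun _ => and_congr_right fun _ => exists_congr fun s =>
      and_congr_right fun _ => forall_congr' fun v => ?_
    tauto
  rw [this]
  refine (isCompact_stdSimplex ℝ V).inter_right ?_
  exact (Set.toFinite _).isClosed_biUnion fun s _ => isClosed_biInter fun v _ =>
    isClosed_eq (continuous_apply v) continuous_const

namespace Geometry.SimplicialComplex

variable {E : Type*} [NormedAddCommGroup E] [NormedSpace ℝ E]

/-- The abstract simplicial complex of a geometric one, on its set of vertices. -/
def toAbstract (K : SimplicialComplex ℝ E) : AbstractSimplicialComplex K.vertices where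
  faces := {s | s.map (Function.Embedding.subtype _) ∈ K.faces}
  isRelLowerSet_faces := by
    intro s hs
    refine ⟨by simpa using K.nonempty_of_mem_faces hs, fun t hts ht => ?_⟩
    exact K.down_closed hs (Finset.map_subset_map.2 hts) (ht.map)
  singleton_mem := fun v => by
    rw [Set.mem_ofPred_eq, Finset.map_singleton]
    exact v.2

theorem mem_toAbstract {K : SimplicialComplex ℝ E} {s : Finset K.vertices} :
    s ∈ K.toAbstract.faces ↔ s.map (Function.Embedding.subtype _) ∈ K.faces := Iff.rfl

theorem eq_zero_of_sum_smul_eq_zero {K : SimplicialComplex ℝ E} {s : Finset K.vertices}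
    (hs : s ∈ K.toAbstract.faces) (w : K.vertices → ℝ) (h0 : ∑ v ∈ s, w v = 0)
    (h1 : ∑ v ∈ s, w v • (v : E) = 0) : ∀ v ∈ s, w v = 0 := by
  have hind := K.indep hs
  let e : s ↪ (s.map (Function.Embedding.subtype _) : Finset E) :=
    ⟨fun v => ⟨v.1.1, by simp⟩, fun u v h => by
      apply Subtype.ext
      apply Subtype.ext
      exact congrArg (fun x => x.1) h⟩
  have hind' := affineIndependent_iff.1 (hind.comp_embedding e) Finset.univ (fun v => w v.1)
    (by rw [Finset.sum_coe_sort s w, h0])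
    (by
      change ∑ v : s, w v.1 • (v.1.1 : E) = 0
      rw [Finset.sum_coe_sort s (fun v => w v • (v : E)), h1])
  exact fun v hv => hind' ⟨v, hv⟩ (Finset.mem_univ _)

/-- The map sends barycentric coordinates to the point they represent. It is a continuous bijection
from a compact space to a Hausdorff one. -/
theorem exists_homeomorph_realization (K : SimplicialComplex ℝ E) [Fintype K.vertices] :
    Nonempty (K.toAbstract.realization ≃ₜ K.space) := by
  classical
  have hsub : ∀ (s : Finset K.vertices) (y : K.vertices → ℝ), (∀ v, y v ≠ 0 → v ∈ s) →
      ∑ v, y v = ∑ v ∈ s, y v ∧ ∑ v, y v • (v : E) = ∑ v ∈ s, y v • (v : E) := by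
    intro s y h
    have h' : ∀ v, v ∉ s → y v = 0 := fun v hv => by
      by_contra h0
      exact hv (h v h0)
    exact ⟨(Finset.sum_subset s.subset_univ fun v _ hv => h' v hv).symm,
      (Finset.sum_subset s.subset_univ fun v _ hv => by rw [h' v hv, zero_smul]).symm⟩
  have hmem : ∀ y ∈ K.toAbstract.realization, ∀ s ∈ K.toAbstract.faces,
      (∀ v, y v ≠ 0 → v ∈ s) → ∑ v, y v • (v : E) ∈
        convexHull ℝ ((s.map (Function.Embedding.subtype _) : Finset E) : Set E) := by
    rintro y ⟨hy0, hy1, -⟩ s hs hys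
    obtain ⟨h1, h2⟩ := hsub s y hys
    rw [h2]
    refine (convex_convexHull ℝ _).sum_mem (fun v _ => hy0 v) (by rw [← h1, hy1]) fun v hv => ?_
    exact subset_convexHull ℝ _ (by simp [hv])
  have hle : ∀ (z : E → ℝ) (t s : Finset K.vertices), s ∈ K.toAbstract.faces → t ⊆ s →
      ∑ v ∈ t, z v = 1 → ∀ y : K.vertices → ℝ, (∀ v, y v ≠ 0 → v ∈ s) → ∑ v, y v = 1 →
      ∑ v ∈ t, z v • (v : E) = ∑ v, y v • (v : E) → ∀ v, y v = if v ∈ t then z v else 0 := by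
    intro z t s hs hts hz y hys hy hzy v
    obtain ⟨h1, h2⟩ := hsub s y hys
    by_cases hv : v ∈ s
    · have := eq_zero_of_sum_smul_eq_zero hs (fun v => y v - if v ∈ t then z v else 0)
        (by
          rw [Finset.sum_sub_distrib, ← h1, hy, Finset.sum_ite_mem,
            Finset.inter_eq_right.2 hts, hz, sub_self])
        (by
          simp only [sub_smul, ite_smul, zero_smul]
          rw [Finset.sum_sub_distrib, ← h2, Finset.sum_ite_mem,
            Finset.inter_eq_right.2 hts, hzy, sub_self]) v hv
      exact sub_eq_zero.1 this
    · rw [if_neg fun h => hv (hts h)]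
      by_contra h0
      exact hv (hys v h0)
  let Φ : K.toAbstract.realization → K.space := fun y => ⟨∑ v, y.1 v • (v : E), by
    obtain ⟨s, hs, hys⟩ := y.2.2.2
    exact K.mem_space_iff.2 ⟨_, hs, hmem y.1 y.2 s hs hys⟩⟩
  have hΦ : Continuous Φ := Continuous.subtype_mk (continuous_finsetSum _ fun v _ =>
    ((continuous_apply v).comp continuous_subtype_val).smul continuous_const) _
  have hinj : Function.Injective Φ := by
    rintro ⟨y, hy⟩ ⟨y', hy'⟩ h
    have h' : ∑ v, y v • (v : E) = ∑ v, y' v • (v : E) := congrArg Subtype.val h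
    obtain ⟨s, hs, hys⟩ := hy.2.2
    obtain ⟨s', hs', hys'⟩ := hy'.2.2
    -- The common image lies in the hull of the intersection of the two carriers. Coordinates `z`
    -- there are also coordinates in each carrier, so affine independence identifies both `y` and
    -- `y'` with `z`.
    have hp := K.inter_subset_convexHull hs hs' ⟨hmem y hy s hs hys, h' ▸ hmem y' hy' s' hs' hys'⟩
    rw [← Finset.coe_inter, ← Finset.map_inter, Finset.mem_convexHull'] at hp
    obtain ⟨z, -, hz1, hz2⟩ := hp
    rw [Finset.sum_map] at hz1 hz2
    have e1 := hle z (s ∩ s') s hs Finset.inter_subset_left hz1 y hys hy.2.1 hz2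
    have e2 := hle z (s ∩ s') s' hs' Finset.inter_subset_right hz1 y' hys' hy'.2.1 (hz2.trans h')
    apply Subtype.ext
    ext v
    exact (e1 v).trans (e2 v).symm
  have hsurj : Function.Surjective Φ := by
    rintro ⟨p, hp⟩
    obtain ⟨S, hS, hpS⟩ := K.mem_space_iff.1 hp
    obtain ⟨z, hz0, hz1, hz2⟩ := Finset.mem_convexHull'.1 hpS
    have hSv : ∀ x ∈ S, x ∈ K.vertices := fun x hx =>
      K.down_closed hS (by simpa using hx) (by simp)
    let s : Finset K.vertices := S.subtype (· ∈ K.vertices)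
    have hsS : s.map (Function.Embedding.subtype _) = S := Finset.subtype_map_of_mem hSv
    have hs : s ∈ K.toAbstract.faces := by rw [mem_toAbstract, hsS]; exact hS
    rw [← hsS, Finset.sum_map] at hz1 hz2
    let y : K.vertices → ℝ := fun v => if v ∈ s then z v else 0
    have hys : ∀ v, y v ≠ 0 → v ∈ s := fun v hv => by
      by_contra h
      simp [y, h] at hv
    obtain ⟨h1, h2⟩ := hsub s y hys
    have hy : y ∈ K.toAbstract.realization := by
      refine ⟨fun v => ?_, ?_, s, hs, hys⟩
      · by_cases hv : v ∈ s
        · simp only [y, hv, if_true]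
          exact hz0 v (by simpa [s] using hv)
        · simp [y, hv]
      · rw [h1, ← hz1]
        exact Finset.sum_congr rfl fun v hv => by simp [y, hv]
    refine ⟨⟨y, hy⟩, Subtype.ext ?_⟩
    change ∑ v, y v • (v : E) = p
    rw [h2, ← hz2]
    exact Finset.sum_congr rfl fun v hv => by simp [y, hv]
  have : CompactSpace K.toAbstract.realization :=
    isCompact_iff_compactSpace.1 K.toAbstract.isCompact_realization
  exact ⟨Continuous.homeoOfEquivCompactToT2 (f := Equiv.ofBijective Φ ⟨hinj, hsurj⟩) hΦ⟩

theorem TriangulatesSphere.finite_vertices {K : SimplicialComplex ℝ E}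
    (hK : K.TriangulatesSphere) : K.vertices.Finite :=
  hK.1.preimage (f := fun x : E => ({x} : Finset E)) (Finset.singleton_injective.injOn)

theorem TriangulatesSphere.puncturesArePlanes {K : SimplicialComplex ℝ E}
    (hK : K.TriangulatesSphere) [Fintype K.vertices] :
    AbstractSimplicialComplex.PuncturesArePlanes K.toAbstract.realization := by
  obtain ⟨φ⟩ := hK.2
  obtain ⟨ψ⟩ := K.exists_homeomorph_realization
  exact puncturesArePlanes_sphere.of_homeomorph (ψ.trans φ)

end Geometry.SimplicialComplex

/-! ### Local and global combinatorics of a triangulated sphere -/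

namespace AbstractSimplicialComplex

variable {V : Type*} [Fintype V] [DecidableEq V]

/-- The vertices `u`, `v`, `w` span a triangle of `K`. -/
def IsTriangle (K : AbstractSimplicialComplex V) (u v w : V) : Prop :=
  {u, v, w} ∈ K.faces ∧ u ≠ v ∧ u ≠ w ∧ v ≠ w

/-- The edge graph of an abstract simplicial complex. -/
def oneSkeleton (K : AbstractSimplicialComplex V) : SimpleGraph V where
  Adj u v := u ≠ v ∧ {u, v} ∈ K.faces
  symm := ⟨fun u v h => ⟨h.1.symm, by rw [Finset.pair_comm]; exact h.2⟩⟩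
  loopless := ⟨fun _ h => h.1 rfl⟩

variable {K : AbstractSimplicialComplex V}

theorem mem_faces_of_subset {s t : Finset V} (ht : t ∈ K.faces) (h : s ⊆ t) (hs : s.Nonempty) :
    s ∈ K.faces :=
  (K.isRelLowerSet_faces ht).2 h hs

theorem IsTriangle.swap {u v w : V} (h : K.IsTriangle u v w) : K.IsTriangle v u w :=
  ⟨by rw [Finset.insert_comm]; exact h.1, h.2.1.symm, h.2.2.2, h.2.2.1⟩

theorem IsTriangle.rotate {u v w : V} (h : K.IsTriangle u v w) : K.IsTriangle v w u :=
  ⟨by rw [Finset.pair_comm w u, Finset.insert_comm]; exact h.1, h.2.2.2, h.2.1.symm,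
    h.2.2.1.symm⟩

theorem IsTriangle.card {u v w : V} (h : K.IsTriangle u v w) : ({u, v, w} : Finset V).card = 3 :=
  Finset.card_eq_three.2 ⟨u, v, w, h.2.1, h.2.2.1, h.2.2.2, rfl⟩

theorem IsTriangle.adj {u v w : V} (h : K.IsTriangle u v w) : K.oneSkeleton.Adj u v :=
  ⟨h.2.1, mem_faces_of_subset h.1 (by grind) (by simp)⟩

theorem exists_isTriangle_of_card {t : Finset V} (ht : t ∈ K.faces) (hc : t.card = 3) {u v : V}
    (huv : u ≠ v) (hu : u ∈ t) (hv : v ∈ t) : ∃ w, K.IsTriangle u v w ∧ t = {u, v, w} := by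
  obtain ⟨x, y, z, hxy, hxz, hyz, rfl⟩ := Finset.card_eq_three.1 hc
  have : ∃ w, u ≠ w ∧ v ≠ w ∧ ({x, y, z} : Finset V) = {u, v, w} := by
    simp only [Finset.mem_insert, Finset.mem_singleton] at hu hv
    rcases hu with rfl | rfl | rfl <;> rcases hv with rfl | rfl | rfl
    all_goals first
      | exact absurd rfl huv
      | exact ⟨x, by grind, by grind, by grind⟩
      | exact ⟨y, by grind, by grind, by grind⟩
      | exact ⟨z, by grind, by grind, by grind⟩
  obtain ⟨w, h1, h2, h3⟩ := this
  exact ⟨w, ⟨h3 ▸ ht, huv, h1, h2⟩, h3⟩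

theorem IsCocycleOn.apply_self {D : Set (Finset V)} {c : V → V → ZMod 2} (hc : IsCocycleOn D c)
    {u : V} (hu : {u} ∈ D) : c u u = 0 := by
  simpa using hc u u u (by simpa using hu)

theorem exists_maximal_face {s : Finset V} (hs : s ∈ K.faces) :
    ∃ t ∈ K.faces, s ⊆ t ∧ ∀ r ∈ K.faces, t ⊆ r → r = t := by
  obtain ⟨t, hst, ht⟩ := (Set.toFinite K.faces).exists_le_maximal hs
  exact ⟨t, ht.1, hst, fun r hr htr => le_antisymm (ht.2 hr htr) htr⟩

/-- Puncturing `σ` and another maximal face `τ` creates a nontrivial class, while puncturing `τ`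
alone does not. So filling in `σ` must destroy a class. A `σ` with more than three vertices is
invisible to 1-cocycles, and over a `σ` with fewer the cocycle extends. -/
theorem card_eq_three_of_maximal [Nontrivial V] (hX : PuncturesArePlanes K.realization)
    {σ : Finset V} (hσ : σ ∈ K.faces) (hmax : ∀ r ∈ K.faces, σ ⊆ r → r = σ) : σ.card = 3 := by
  obtain ⟨a, b, hab⟩ := exists_pair_ne V
  have hne : σ ≠ Finset.univ := fun h => univ_notMem_faces hX hab (h ▸ hσ)
  obtain ⟨v, hv⟩ : ∃ v, v ∉ σ := by simpa [Finset.eq_univ_iff_forall] using hne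
  obtain ⟨τ, hτ, hvτ, hτmax⟩ := exists_maximal_face (K.singleton_mem v)
  have hvτ : v ∈ τ := by simpa using hvτ
  have hστ : σ ≠ τ := by
    rintro rfl
    exact hv hvτ
  obtain ⟨c, hc, hnc⟩ := exists_not_isCoboundaryOn_facesAvoiding_pair hX hσ hτ hστ (by
    intro s hs h1 h2
    rw [hmax s hs h1] at h2
    exact hστ (hτmax σ hσ h2))
  by_contra hcard
  have hmem : ∀ s ∈ K.facesAvoiding {τ}, ¬ σ ⊆ s → s ∈ K.facesAvoiding {σ, τ} := by
    intro s hs h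
    refine ⟨hs.1, ?_⟩
    rintro _ (rfl | rfl)
    exacts [h, hs.2 _ rfl]
  have hmem' : ∀ s ∈ K.facesAvoiding {σ, τ}, s ∈ K.facesAvoiding {τ} := by
    rintro s hs
    refine ⟨hs.1, ?_⟩
    rintro _ rfl
    exact hs.2 _ (by simp)
  rcases lt_or_gt_of_ne hcard with hlt | hgt
  · have hself : ∀ s ∈ K.facesAvoiding {σ, τ}, ∀ x ∈ s, ∀ y ∈ s, x ∈ σ → y ∈ σ → c x y = 0 := by
      intro s hs x hx y hy hxσ hyσ
      have hss : ¬ σ ⊆ s := hs.2 σ (by simp)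
      have hxy : x = y := by
        by_contra hxy
        have : ({x, y} : Finset V) = σ := Finset.eq_of_subset_of_card_le (by grind)
          (by rw [Finset.card_pair hxy]; omega)
        exact hss (this ▸ by grind)
      subst hxy
      have hx1 : {x} ∈ K.facesAvoiding {σ, τ} :=
        ⟨K.singleton_mem x, fun ρ hρ h => hs.2 ρ hρ (h.trans (by simpa using hx))⟩
      exact hc.apply_self hx1
    have heq : ∀ s ∈ K.facesAvoiding {σ, τ}, ∀ x ∈ s, ∀ y ∈ s,
        (if x ∈ σ ∧ y ∈ σ then 0 else c x y) = c x y := by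
      intro s hs x hx y hy
      split_ifs with h
      · exact (hself s hs x hx y hy h.1 h.2).symm
      · rfl
    -- Zero on pairs inside `σ` agrees with `c` on the old faces, where such pairs are diagonal
    -- because `σ` has at most two vertices. By maximality `σ` is the only new face.
    obtain ⟨f, hf⟩ := isCoboundaryOn_facesAvoiding_single hX hτ
      (c := fun x y => if x ∈ σ ∧ y ∈ σ then 0 else c x y) (by
        intro x y z h
        by_cases hs : σ ⊆ {x, y, z}
        · have := hmax _ h.1 hs
          have hx : x ∈ σ := this ▸ by simp
          have hy : y ∈ σ := this ▸ by simp
          have hz : z ∈ σ := this ▸ by simp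
          simp [hx, hy, hz]
        · have hD := hmem _ h hs
          simp only [heq _ hD x (by simp) y (by simp), heq _ hD y (by simp) z (by simp),
            heq _ hD x (by simp) z (by simp)]
          exact hc x y z hD)
    refine hnc ⟨f, fun x y h => ?_⟩
    rw [← hf x y (hmem' _ h)]
    exact (heq _ h x (by simp) y (by simp)).symm
  · obtain ⟨f, hf⟩ := isCoboundaryOn_facesAvoiding_single hX hτ (c := c) fun x y z h =>
      hc x y z (hmem _ h fun hs => by
        have := Finset.card_le_card hs
        have := Finset.card_le_three (a := x) (b := y) (c := z)
        omega)
    exact hnc ⟨f, fun x y h => hf x y (hmem' _ h)⟩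

theorem exists_triangle_superset [Nontrivial V] (hX : PuncturesArePlanes K.realization)
    {s : Finset V} (hs : s ∈ K.faces) : ∃ t ∈ K.faces, s ⊆ t ∧ t.card = 3 := by
  obtain ⟨t, ht, hst, hmax⟩ := exists_maximal_face hs
  exact ⟨t, ht, hst, card_eq_three_of_maximal hX ht hmax⟩

theorem eq_of_triangle_subset [Nontrivial V] (hX : PuncturesArePlanes K.realization)
    {s t : Finset V} (hs : s ∈ K.faces) (ht : t.card = 3) (hts : t ⊆ s) : s = t := by
  obtain ⟨r, hr, hsr, hcard⟩ := exists_triangle_superset hX hs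
  have := Finset.card_le_card hsr
  exact (Finset.eq_of_subset_of_card_le hts (by omega)).symm

/-- No edge lies in three triangles. -/
theorem eq_or_eq_of_isTriangle [Nontrivial V] (hX : PuncturesArePlanes K.realization)
    {u v w₁ w₂ w₃ : V} (h1 : K.IsTriangle u v w₁) (h2 : K.IsTriangle u v w₂)
    (h3 : K.IsTriangle u v w₃) (h12 : w₁ ≠ w₂) : w₃ = w₁ ∨ w₃ = w₂ := by
  by_contra! hcon
  have hne : ({u, v, w₁} : Finset V) ≠ {u, v, w₂} := by
    intro h
    have : w₁ ∈ ({u, v, w₂} : Finset V) := h ▸ by simp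
    have := h1.2
    grind
  have hsep : ∀ s ∈ K.faces, {u, v, w₁} ⊆ s → ¬ {u, v, w₂} ⊆ s := by
    intro s hs hs1 hs2
    exact hne ((eq_of_triangle_subset hX hs h1.card hs1).symm.trans
      (eq_of_triangle_subset hX hs h2.card hs2))
  obtain ⟨c, hc, hnc⟩ := exists_not_isCoboundaryOn_facesAvoiding_pair hX h1.1 h2.1 hne hsep
  have hmem : ∀ s ∈ K.facesAvoiding {{u, v}}, s ∈ K.facesAvoiding {{u, v, w₁}, {u, v, w₂}} := by
    intro s hs
    refine ⟨hs.1, ?_⟩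
    rintro _ (rfl | rfl) h <;> exact hs.2 _ rfl (Finset.Subset.trans (by grind) h)
  -- Without the edge `uv` the cocycle splits. The third triangle then computes `c u v` through
  -- `w₃`, so the same `f` splits it on `uv` too, a contradiction.
  obtain ⟨f, hf⟩ := isCoboundaryOn_facesAvoiding_single hX h1.adj.2 (c := c)
    fun x y z h => hc x y z (hmem _ h)
  have hthird : {u, v, w₃} ∈ K.facesAvoiding {{u, v, w₁}, {u, v, w₂}} := by
    refine ⟨h3.1, ?_⟩
    have := h1.2
    have := h2.2
    rintro _ (rfl | rfl) h
    · have : w₁ ∈ ({u, v, w₃} : Finset V) := h (by simp)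
      grind
    · have : w₂ ∈ ({u, v, w₃} : Finset V) := h (by simp)
      grind
  have hu3 : {u, w₃} ∈ K.facesAvoiding {{u, v}} := by
    refine ⟨h3.rotate.rotate.swap.adj.2, ?_⟩
    rintro _ rfl h
    have : v ∈ ({u, w₃} : Finset V) := h (by simp)
    have := h3.2
    grind
  have hv3 : {v, w₃} ∈ K.facesAvoiding {{u, v}} := by
    refine ⟨h3.rotate.adj.2, ?_⟩
    rintro _ rfl h
    have : u ∈ ({v, w₃} : Finset V) := h (by simp)
    have := h3.2
    grind
  have h2z : ∀ a : ZMod 2, a + a = 0 := CharTwo.add_self_eq_zero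
  have huv : c u v = f u + f v := by
    have := hc u w₃ v (by convert hthird using 1; grind)
    rw [hf u w₃ hu3, hf w₃ v (by rwa [Finset.pair_comm w₃ v])] at this
    rw [← this]
    linear_combination h2z (f w₃)
  have hvu : c v u = f v + f u := by
    have := hc v w₃ u (by convert hthird using 1; grind)
    rw [hf v w₃ hv3, hf w₃ u (by rwa [Finset.pair_comm w₃ u])] at this
    rw [← this]
    linear_combination h2z (f w₃)
  refine hnc ⟨f, fun x y h => ?_⟩
  by_cases hxy : {u, v} ⊆ ({x, y} : Finset V)
  · have := h1.2
    have hu : u ∈ ({x, y} : Finset V) := hxy (by simp)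
    have hv : v ∈ ({x, y} : Finset V) := hxy (by simp)
    simp only [Finset.mem_insert, Finset.mem_singleton] at hu hv
    rcases hu with rfl | rfl <;> rcases hv with rfl | rfl
    · exact absurd rfl h1.2.1
    · exact huv
    · exact hvu
    · exact absurd rfl h1.2.1
  · exact hf x y ⟨h.1, by rintro _ rfl; exact hxy⟩

/-- No edge lies in just one triangle. -/
theorem exists_isTriangle_ne [Nontrivial V] (hX : PuncturesArePlanes K.realization)
    {u v w : V} (h : K.IsTriangle u v w) : ∃ w', w' ≠ w ∧ K.IsTriangle u v w' := by
  by_contra! hcon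
  have hfull : ∀ s ∈ K.facesAvoiding {{u, v, w}}, {u, v} ⊆ s → s = {u, v} := by
    intro s hs hsub
    by_contra hne
    obtain ⟨x, hx, hxe⟩ : ∃ x ∈ s, x ∉ ({u, v} : Finset V) :=
      Finset.not_subset.1 fun h' => hne (Finset.Subset.antisymm h' hsub)
    have hux : u ∈ s := hsub (by simp)
    have hvx : v ∈ s := hsub (by simp)
    have htri : K.IsTriangle u v x :=
      ⟨mem_faces_of_subset hs.1 (by grind) (by simp), h.2.1, by grind, by grind⟩
    have hxw : x = w := by
      by_contra hxw
      exact hcon x hxw htri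
    exact hs.2 _ rfl (by grind)
  have h2z : ∀ a : ZMod 2, a + a = 0 := CharTwo.add_self_eq_zero
  let g : V → ZMod 2 := fun x => if x = u then 1 else 0
  -- This is the indicator of the edge `uv`. Once its only triangle is removed it is a cocycle, so
  -- it has a potential `f`, constant along all other edges. Those connect `u` to `v`, forcing `f u
  -- = f v`.
  let c : V → V → ZMod 2 := fun x y => if x ∈ ({u, v} : Finset V) ∧ y ∈ ({u, v} : Finset V)
    then g x + g y else 0
  have hsmall : ∀ s : Finset V, ¬ {u, v} ⊆ s → ∀ x ∈ s, ∀ y ∈ s, c x y = 0 := by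
    intro s hs x hx y hy
    simp only [c]
    split_ifs with hxy
    · have : x = y := by
        by_contra hne
        have hxy1 := hxy.1
        have hxy2 := hxy.2
        apply hs
        grind
      rw [this, h2z]
    · rfl
  obtain ⟨f, hf⟩ := isCoboundaryOn_facesAvoiding_single hX h.1 (c := c) (by
    intro x y z hs
    by_cases hsub : {u, v} ⊆ ({x, y, z} : Finset V)
    · have heq := hfull _ hs hsub
      have hx : x ∈ ({u, v} : Finset V) := heq ▸ by simp
      have hy : y ∈ ({u, v} : Finset V) := heq ▸ by simp
      have hz : z ∈ ({u, v} : Finset V) := heq ▸ by simp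
      simp only [c, hx, hy, hz, and_self, if_true]
      linear_combination h2z (g y)
    · rw [hsmall _ hsub x (by simp) y (by simp), hsmall _ hsub y (by simp) z (by simp),
        hsmall _ hsub x (by simp) z (by simp), add_zero])
  have hmem : ∀ s ∈ K.faces, ¬ {u, v} ⊆ s → s ∈ K.facesAvoiding {{u, v, w}} := by
    intro s hs h'
    refine ⟨hs, ?_⟩
    rintro _ rfl h''
    exact h' (Finset.Subset.trans (by grind) h'')
  have hfuv : f u = f v := by
    refine eq_of_facesAvoiding_single hX h.adj.2 f (fun x y hxy => ?_) ?_ ?_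
    · have hne := hxy.2 _ rfl
      have h0 := hf x y (hmem _ hxy.1 hne)
      rw [hsmall _ hne x (by simp) y (by simp)] at h0
      exact (CharTwo.add_eq_zero.1 h0.symm)
    · refine ⟨K.singleton_mem u, ?_⟩
      rintro _ rfl h'
      have : v ∈ ({u} : Finset V) := h' (by simp)
      exact h.2.1 (Finset.mem_singleton.1 this).symm
    · refine ⟨K.singleton_mem v, ?_⟩
      rintro _ rfl h'
      have : u ∈ ({v} : Finset V) := h' (by simp)
      exact h.2.1 (by simpa using this)
  have huv : {u, v} ∈ K.facesAvoiding {{u, v, w}} := by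
    refine ⟨h.adj.2, ?_⟩
    rintro _ rfl h'
    have : w ∈ ({u, v} : Finset V) := h' (by simp)
    have := h.2
    grind
  have h1 := hf u v huv
  rw [hfuv, h2z] at h1
  simp [c, g, h.2.1.symm] at h1

/-- Every edge lies in exactly two triangles. -/
theorem exists_two_triangles [Nontrivial V] (hX : PuncturesArePlanes K.realization) {u v : V}
    (huv : K.oneSkeleton.Adj u v) :
    ∃ w w', w ≠ w' ∧ ∀ x, K.IsTriangle u v x ↔ x = w ∨ x = w' := by
  obtain ⟨t, ht, hst, hc⟩ := exists_triangle_superset hX huv.2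
  obtain ⟨w, hw, -⟩ := exists_isTriangle_of_card ht hc huv.1 (hst (by simp)) (hst (by simp))
  obtain ⟨w', hne, hw'⟩ := exists_isTriangle_ne hX hw
  refine ⟨w, w', hne.symm, fun x => ⟨fun hx => eq_or_eq_of_isTriangle hX hw hw' hx hne.symm, ?_⟩⟩
  rintro (rfl | rfl) <;> assumption

/-- The complex has trivial first cohomology. -/
theorem exists_splitting_of_triangle_sum_eq_zero [Nontrivial V]
    (hX : PuncturesArePlanes K.realization) (c : Finset V → ZMod 2)
    (hc : ∀ u v w, K.IsTriangle u v w → c {u, v} + c {v, w} + c {u, w} = 0) :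
    ∃ f : V → ZMod 2, ∀ u v, K.oneSkeleton.Adj u v → c {u, v} = f u + f v := by
  have h2z : ∀ a : ZMod 2, a + a = 0 := CharTwo.add_self_eq_zero
  obtain ⟨a, -⟩ := exists_pair_ne V
  obtain ⟨t, ht, -, htc⟩ := exists_triangle_superset hX (K.singleton_mem a)
  -- Puncturing one triangle keeps every edge, so a splitting on the remaining faces is a splitting
  -- on the whole edge graph.
  obtain ⟨f, hf⟩ := isCoboundaryOn_facesAvoiding_single hX ht
    (c := fun x y => if x = y then 0 else c {x, y}) (by
      intro x y z hs
      by_cases hxy : x = y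
      · simp [hxy]
      by_cases hyz : y = z
      · simp [hyz]
      by_cases hxz : x = z
      · subst hxz
        simp only [hxy, hyz, if_false, if_true]
        rw [Finset.pair_comm y x, h2z]
      · simp only [hxy, hyz, hxz, if_false]
        exact CharTwo.add_eq_zero.1 (hc x y z ⟨hs.1, hxy, hxz, hyz⟩))
  refine ⟨f, fun u v h => ?_⟩
  rw [← hf u v ⟨h.2, ?_⟩]
  · exact (if_neg h.1).symm
  rintro _ rfl hsub
  have := Finset.card_le_card hsub
  rw [Finset.card_pair h.1] at this
  omega

theorem eq_of_oneSkeleton_adj (hX : PuncturesArePlanes K.realization) [Nontrivial V] {α : Type*}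
    (f : V → α) (hf : ∀ u v, K.oneSkeleton.Adj u v → f u = f v) (u v : V) : f u = f v := by
  obtain ⟨a, -⟩ := exists_pair_ne V
  obtain ⟨t, ht, -, htc⟩ := exists_triangle_superset hX (K.singleton_mem a)
  have hsing : ∀ x : V, {x} ∈ K.facesAvoiding {t} := by
    refine fun x => ⟨K.singleton_mem x, ?_⟩
    rintro _ rfl h
    have := Finset.card_le_card h
    rw [Finset.card_singleton] at this
    omega
  refine eq_of_facesAvoiding_single hX ht f (fun x y h => ?_) (hsing u) (hsing v)
  by_cases hxy : x = y
  · rw [hxy]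
  · exact hf x y ⟨hxy, h.1⟩

theorem oneSkeleton_connected (hX : PuncturesArePlanes K.realization) [Nontrivial V] :
    K.oneSkeleton.Connected := by
  refine ⟨fun u v => ?_⟩
  have := eq_of_oneSkeleton_adj hX (fun x => K.oneSkeleton.Reachable u x)
    (fun x y h => propext ⟨fun h' => h'.trans h.reachable, fun h' => h'.trans h.symm.reachable⟩)
    u v
  exact this ▸ SimpleGraph.Reachable.refl u

/-- Vertex links are connected. -/
theorem eq_of_isTriangle_of_adj (hX : PuncturesArePlanes K.realization) [Nontrivial V] {v : V}
    (A : V → ZMod 2) (hA : ∀ w w', K.IsTriangle v w w' → A w = A w') {w w' : V}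
    (hw : K.oneSkeleton.Adj v w) (hw' : K.oneSkeleton.Adj v w') : A w = A w' := by
  classical
  have h2z : ∀ a : ZMod 2, a + a = 0 := CharTwo.add_self_eq_zero
  -- The cochain is `A x` on each edge `vx` and zero elsewhere, a cocycle because `A` is constant
  -- along link edges. Its potential is constant on the connected complement of `v`, so `A` takes
  -- equal values at the neighbours.
  let c : Finset V → ZMod 2 := fun e => if v ∈ e then ∑ x ∈ e.erase v, A x else 0
  have hcv : ∀ x, v ≠ x → c {v, x} = A x := by
    intro x hx
    have : ({v, x} : Finset V).erase v = {x} := by grind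
    simp [c, this]
  have hc0 : ∀ x y, v ≠ x → v ≠ y → c {x, y} = 0 := by
    intro x y hx hy
    simp [c, hx, hy]
  obtain ⟨f, hf⟩ := exists_splitting_of_triangle_sum_eq_zero hX c (by
    intro x y z h
    obtain ⟨h1, h2, h3⟩ := h.2
    by_cases hx : v = x
    · subst hx
      rw [hcv y h1, hcv z h2, hc0 y z h1 h2, hA y z h]
      linear_combination h2z (A z)
    by_cases hy : v = y
    · subst hy
      rw [Finset.pair_comm x v, hcv x hx, hcv z h3, hc0 x z hx h3, hA x z h.swap]
      linear_combination h2z (A z)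
    by_cases hz : v = z
    · subst hz
      rw [Finset.pair_comm y v, Finset.pair_comm x v, hcv x hx, hcv y hy, hc0 x y hx hy,
        hA x y h.rotate.rotate]
      linear_combination h2z (A y)
    · rw [hc0 _ _ hx hy, hc0 _ _ hy hz, hc0 _ _ hx hz]
      simp)
  have hff : f w = f w' := by
    refine eq_of_facesAvoiding_single hX (K.singleton_mem v) f (fun x y h => ?_) ?_ ?_
    · have hv : v ∉ ({x, y} : Finset V) := by
        intro hv
        exact h.2 _ rfl (by simpa using hv)
      by_cases hxy : x = y
      · rw [hxy]
      have h0 := hf x y ⟨hxy, h.1⟩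
      rw [hc0 x y (by grind) (by grind)] at h0
      exact CharTwo.add_eq_zero.1 h0.symm
    · refine ⟨K.singleton_mem w, ?_⟩
      rintro _ rfl h
      exact hw.1 (by simpa using h)
    · refine ⟨K.singleton_mem w', ?_⟩
      rintro _ rfl h
      exact hw'.1 (by simpa using h)
  rw [← hcv w hw.1, ← hcv w' hw'.1, hf v w hw, hf v w' hw', hff]

end AbstractSimplicialComplex

/-! ### Labellings along a forest -/

/-- Local transition relations along the edges of a finite forest are realized by some labelling
of the vertices, with prescribed label at one vertex. -/
theorem SimpleGraph.IsAcyclic.exists_labelling {W X : Type*} [Finite W] {Γ : SimpleGraph W}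
    (hΓ : Γ.IsAcyclic) (R : W → W → X → X → Prop)
    (hsymm : ∀ s t x y, Γ.Adj s t → R s t x y → R t s y x)
    (hext : ∀ s t x, Γ.Adj s t → ∃ y, R s t x y) (t₀ : W) (x₀ : X) :
    ∃ p : W → X, p t₀ = x₀ ∧ ∀ s t, Γ.Adj s t → R s t (p s) (p t) := by
  classical
  induction hn : Γ.edgeSet.ncard generalizing Γ t₀ x₀ with
  | zero =>
    have : Γ.edgeSet = ∅ := (Set.ncard_eq_zero (Set.toFinite _)).1 hn
    refine ⟨fun _ => x₀, rfl, fun s t h => ?_⟩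
    have h' : s(s, t) ∈ Γ.edgeSet := h
    simp [this] at h'
  | succ n ih =>
    obtain ⟨e, he⟩ : Γ.edgeSet.Nonempty := Set.nonempty_of_ncard_ne_zero (by omega)
    induction e using Sym2.ind with | _ s t => ?_
    have hadj : Γ.Adj s t := he
    have hbridge := SimpleGraph.isBridge_iff.1
      (SimpleGraph.isAcyclic_iff_forall_adj_isBridge.1 hΓ hadj)
    let Γ' := Γ.deleteEdges {s(s, t)}
    have hle : Γ' ≤ Γ := SimpleGraph.deleteEdges_le _
    have hcard : Γ'.edgeSet.ncard = n := by
      rw [SimpleGraph.edgeSet_deleteEdges, Set.ncard_sdiff_singleton_of_mem he]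
      omega
    have hadj' : ∀ x y, Γ.Adj x y → Γ'.Adj x y ∨ (x = s ∧ y = t) ∨ (x = t ∧ y = s) := by
      intro x y hxy
      by_cases h : s(x, y) = s(s, t)
      · exact Or.inr (Sym2.eq_iff.1 h)
      · exact Or.inl (by simpa [Γ', SimpleGraph.deleteEdges_adj, hxy] using h)
    have IH := fun t₀ x₀ => ih (Γ := Γ') (hΓ.anti hle)
      (fun s t x y h => hsymm s t x y (hle h)) (fun s t x h => hext s t x (hle h)) t₀ x₀ hcard
    -- Deleting the edge separates `s` from `t`. With `t` the end not joined to `t₀`, the component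
    -- of `t` is relabelled starting from a value `y` compatible with the label of `s`.
    have main : ∀ s t, Γ.Adj s t → ¬ Γ'.Reachable s t → ¬ Γ'.Reachable t t₀ →
        (∀ x y, Γ.Adj x y → Γ'.Adj x y ∨ (x = s ∧ y = t) ∨ (x = t ∧ y = s)) →
        ∃ p : W → X, p t₀ = x₀ ∧ ∀ s t, Γ.Adj s t → R s t (p s) (p t) := by
      intro s t hst hs ht hcases
      obtain ⟨p₁, hp₁, h₁⟩ := IH t₀ x₀
      obtain ⟨y, hy⟩ := hext s t (p₁ s) hst
      obtain ⟨p₂, hp₂, h₂⟩ := IH t y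
      refine ⟨fun z => if Γ'.Reachable t z then p₂ z else p₁ z, by simp [ht, hp₁], ?_⟩
      have hR : R s t (if Γ'.Reachable t s then p₂ s else p₁ s)
          (if Γ'.Reachable t t then p₂ t else p₁ t) := by
        rw [if_neg fun h => hs h.symm, if_pos (SimpleGraph.Reachable.refl t), hp₂]
        exact hy
      intro x z hxz
      rcases hcases x z hxz with h | ⟨rfl, rfl⟩ | ⟨rfl, rfl⟩
      · have hiff : Γ'.Reachable t x ↔ Γ'.Reachable t z :=
          ⟨fun h' => h'.trans h.reachable, fun h' => h'.trans h.symm.reachable⟩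
        by_cases hx : Γ'.Reachable t x
        · simp only [hx, hiff.1 hx, if_true]
          exact h₂ x z h
        · have hz : ¬ Γ'.Reachable t z := fun h' => hx (hiff.2 h')
          simp only [hx, hz, if_false]
          exact h₁ x z h
      · exact hR
      · exact hsymm _ _ _ _ hst hR
    by_cases h : Γ'.Reachable t t₀
    · refine main t s hadj.symm (fun h' => hbridge h'.symm) (fun h' => hbridge (h'.trans h.symm)) ?_
      intro x y hxy
      have := hadj' x y hxy
      tauto
    · exact main s t hadj hbridge h hadj'

/-! ### Link cycles and the reflection rule -/

namespace AbstractSimplicialComplex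

variable {V : Type*} [Fintype V] [DecidableEq V] {K : AbstractSimplicialComplex V}

/-- The link of a vertex, as a graph on all vertices. -/
def linkGraph (K : AbstractSimplicialComplex V) (v : V) : SimpleGraph V where
  Adj w w' := K.IsTriangle v w w'
  symm := ⟨fun _ _ h => h.swap.rotate⟩
  loopless := ⟨fun _ h => h.2.2.2 rfl⟩

/-- The neighbours of `v` can be arranged in a cycle, starting with any edge of the link. -/
theorem exists_link_cycle [Nontrivial V] (hX : PuncturesArePlanes K.realization) {v w₀ w₁ : V}
    (h : K.IsTriangle v w₀ w₁) :
    ∃ (d : ℕ) (x : ℕ → V), d = (K.oneSkeleton.neighborSet v).ncard ∧ 3 ≤ d ∧ x 0 = w₀ ∧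
      x 1 = w₁ ∧ x d = w₀ ∧ (∀ i < d, K.IsTriangle v (x i) (x (i + 1))) ∧
      (∀ i, 1 ≤ i → i < d → x i ≠ w₀) ∧ (∀ i, i + 2 ≤ d → x i ≠ x (i + 2)) ∧
      x (d - 1) ≠ w₁ := by
  have hadj : ∀ w, K.oneSkeleton.Adj v w ↔ ∃ w', K.IsTriangle v w w' := by
    refine fun w => ⟨fun hw => ?_, fun ⟨w', hw'⟩ => hw'.adj⟩
    obtain ⟨a, b, -, hab⟩ := exists_two_triangles hX hw
    exact ⟨a, (hab a).2 (Or.inl rfl)⟩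
  have hcyc : (K.linkGraph v).IsCycles := by
    rintro w ⟨w', hw'⟩
    obtain ⟨a, b, hne, hab⟩ := exists_two_triangles hX (IsTriangle.adj hw')
    have : (K.linkGraph v).neighborSet w = {a, b} := by
      ext x
      exact hab x
    rw [this, Set.ncard_pair hne]
  have hreach : ∀ w, K.oneSkeleton.Adj v w → (K.linkGraph v).Reachable w₀ w := by
    intro w hw
    classical
    have := eq_of_isTriangle_of_adj hX
      (fun x => if (K.linkGraph v).Reachable w₀ x then (1 : ZMod 2) else 0)
      (fun x y hxy => by
        have hl : (K.linkGraph v).Adj x y := hxy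
        have hiff : (K.linkGraph v).Reachable w₀ x ↔ (K.linkGraph v).Reachable w₀ y :=
          ⟨fun h' => h'.trans hl.reachable, fun h' => h'.trans hl.symm.reachable⟩
        simp only [hiff]) h.adj hw
    by_contra hcon
    simp [hcon] at this
  obtain ⟨p, hp, hverts⟩ := hcyc.exists_cycle_toSubgraph_verts_eq_connectedComponentSupp
    (v := w₀) (c := (K.linkGraph v).connectedComponentMk w₀) rfl ⟨w₁, h⟩
  have hlen := hp.three_le_length
  have hsupp : ∀ w, K.oneSkeleton.Adj v w ↔ ∃ i, 1 ≤ i ∧ i ≤ p.length ∧ p.getVert i = w := by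
    intro w
    constructor
    · intro hw
      have : w ∈ p.toSubgraph.verts := by
        rw [hverts]
        exact SimpleGraph.ConnectedComponent.sound (hreach w hw).symm
      rw [p.mem_verts_toSubgraph, SimpleGraph.Walk.mem_support_iff_exists_getVert] at this
      obtain ⟨i, hi, hil⟩ := this
      rcases Nat.eq_zero_or_pos i with rfl | hpos
      · exact ⟨p.length, by omega, le_rfl, by rw [← hi, p.getVert_zero, p.getVert_length]⟩
      · exact ⟨i, hpos, hil, hi⟩
    · rintro ⟨i, hi, hil, rfl⟩
      have h1 : K.IsTriangle v (p.getVert (i - 1)) (p.getVert i) := by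
        have := p.adj_getVert_succ (i := i - 1) (by omega)
        rwa [Nat.sub_add_cancel hi] at this
      exact h1.swap.rotate.adj
  have hcard : (K.oneSkeleton.neighborSet v).ncard = p.length := by
    have : K.oneSkeleton.neighborSet v = p.getVert '' {i | 1 ≤ i ∧ i ≤ p.length} := by
      ext w
      simp [hsupp w, and_assoc]
    rw [this, hp.getVert_injOn.ncard_image]
    have : {i | 1 ≤ i ∧ i ≤ p.length} = (Finset.Icc 1 p.length : Set ℕ) := by
      ext i
      simp
    rw [this, Set.ncard_coe_finset]
    simp
  have key : ∀ q : (K.linkGraph v).Walk w₀ w₀, q.IsCycle → q.length = p.length → q.snd = w₁ →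
      ∃ (d : ℕ) (x : ℕ → V), d = (K.oneSkeleton.neighborSet v).ncard ∧ 3 ≤ d ∧ x 0 = w₀ ∧
      x 1 = w₁ ∧ x d = w₀ ∧ (∀ i < d, K.IsTriangle v (x i) (x (i + 1))) ∧
      (∀ i, 1 ≤ i → i < d → x i ≠ w₀) ∧ (∀ i, i + 2 ≤ d → x i ≠ x (i + 2)) ∧
      x (d - 1) ≠ w₁ := by
    intro q hq hql hsnd
    have hinj : ∀ i j, 1 ≤ i → i ≤ q.length → 1 ≤ j → j ≤ q.length →
        q.getVert i = q.getVert j → i = j := fun i j h1 h2 h3 h4 h5 =>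
      hq.getVert_injOn ⟨h1, h2⟩ ⟨h3, h4⟩ h5
    refine ⟨q.length, q.getVert, by rw [hcard, hql], by omega, q.getVert_zero, hsnd,
      q.getVert_length, fun i hi => q.adj_getVert_succ hi, fun i h1 h2 h3 => ?_,
      fun i hi h3 => ?_, fun h3 => ?_⟩
    · have := hinj i q.length h1 h2.le (by omega) le_rfl (by rw [h3, q.getVert_length])
      omega
    · rcases Nat.eq_zero_or_pos i with rfl | hpos
      · have := hinj q.length 2 (by omega) le_rfl (by omega) (by omega)
          (by rw [q.getVert_length, ← h3, q.getVert_zero])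
        omega
      · have := hinj i (i + 2) hpos (by omega) (by omega) hi h3
        omega
    · have := hinj (q.length - 1) 1 (by omega) (by omega) le_rfl (by omega) (by rw [h3, ← hsnd])
      omega
  obtain ⟨a, b, hne, hab⟩ := exists_two_triangles hX h.adj
  have h1 : K.IsTriangle v w₀ p.snd := p.adj_snd hp.not_nil
  have h2 : K.IsTriangle v w₀ p.penultimate := (p.adj_penultimate hp.not_nil).symm
  have hsp := hp.snd_ne_penultimate
  -- The link has just two edges at `w₀`, and the cycle leaves by one and returns by the other. So
  -- `p` or its reverse starts towards `w₁`.
  by_cases hs : p.snd = w₁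
  · exact key p hp rfl hs
  · refine key p.reverse hp.reverse (by simp) ?_
    rw [SimpleGraph.Walk.snd_reverse]
    have := (hab _).1 h
    have := (hab _).1 h1
    have := (hab _).1 h2
    grind

/-- Two labellings of triangles `{u, v, w}` and `{u, v, w'}` fit together along `{u, v}`. -/
def Glues (α β : ℝ) (q q' : V → ℝ) (u v w w' : V) : Prop :=
  q' u = q u ∧ q' v = q v ∧ q' w' = α * q w + β * (q u + q v)

/-- The labels of the two triangles at the edge `{u, v}` fit together. -/
def ConsistentAt (K : AbstractSimplicialComplex V) (α β : ℝ) (p : Finset V → V → ℝ) (u v : V) :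
    Prop :=
  ∀ w w', K.IsTriangle u v w → K.IsTriangle u v w' → w ≠ w' →
    Glues α β (p {u, v, w}) (p {u, v, w'}) u v w w'

theorem ConsistentAt.symm {α β : ℝ} {p : Finset V → V → ℝ} {u v : V}
    (h : K.ConsistentAt α β p u v) : K.ConsistentAt α β p v u := by
  intro w w' hw hw' hne
  obtain ⟨h1, h2, h3⟩ := h w w' hw.swap hw'.swap hne
  rw [Finset.insert_comm v u, Finset.insert_comm v u]
  exact ⟨h2, h1, by rw [h3, add_comm (p _ u)]⟩

/-- Going once around `v` from one side of the edge `{v, w₀}` to the other, the labels follow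
the linear recurrence. -/
theorem apply_of_consistentAt_link [Nontrivial V] (hX : PuncturesArePlanes K.realization)
    {α β : ℝ} {p : Finset V → V → ℝ} {v w₀ w₁ w' : V} (h₁ : K.IsTriangle v w₀ w₁)
    (h' : K.IsTriangle v w₀ w') (hne : w₁ ≠ w')
    (hcons : ∀ w, K.oneSkeleton.Adj v w → w ≠ w₀ → K.ConsistentAt α β p v w) (y : ℕ → ℝ)
    (hy0 : y 0 = p {v, w₀, w₁} w₀) (hy1 : y 1 = p {v, w₀, w₁} w₁)
    (hy : ∀ i, y (i + 2) = α * y i + β * (p {v, w₀, w₁} v + y (i + 1))) :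
    1 ≤ (K.oneSkeleton.neighborSet v).ncard ∧
    p {v, w₀, w'} v = p {v, w₀, w₁} v ∧
      p {v, w₀, w'} w' = y ((K.oneSkeleton.neighborSet v).ncard - 1) ∧
      p {v, w₀, w'} w₀ = y ((K.oneSkeleton.neighborSet v).ncard) := by
  obtain ⟨d, x, hd, hd3, hx0, hx1, hxd, htri, hxne, hx2, hlast⟩ := exists_link_cycle hX h₁
  rw [← hd]
  have hind : ∀ i < d, p {v, x i, x (i + 1)} v = p {v, w₀, w₁} v ∧
      p {v, x i, x (i + 1)} (x i) = y i ∧ p {v, x i, x (i + 1)} (x (i + 1)) = y (i + 1) := by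
    intro i
    induction i with
    | zero => exact fun _ => by rw [hx0, zero_add, hx1]; exact ⟨rfl, hy0.symm, hy1.symm⟩
    | succ i ih =>
      intro hi
      obtain ⟨e1, e2, e3⟩ := ih (by omega)
      have t1 := (htri i (by omega)).swap.rotate
      have t2 := htri (i + 1) hi
      obtain ⟨g1, g2, g3⟩ := hcons (x (i + 1)) t2.adj (hxne _ (by omega) hi) _ _ t1 t2
        (hx2 i (by omega))
      rw [Finset.pair_comm (x (i + 1)) (x i)] at g1 g2 g3
      exact ⟨g1.trans e1, g2.trans e3, by rw [g3, e1, e2, e3, hy]⟩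
  -- The last triangle of the turn contains the edge `v w₀` and is not the first one, so it is the
  -- triangle on the other side.
  have hlast' : x (d - 1) = w' := by
    have t := htri (d - 1) (by omega)
    rw [Nat.sub_add_cancel (by omega : 1 ≤ d), hxd] at t
    obtain ⟨a, b, -, hab⟩ := exists_two_triangles hX h₁.adj
    have e1 := (hab _).1 h₁
    have e2 := (hab _).1 h'
    have e3 := (hab _).1 t.swap.rotate
    grind
  obtain ⟨e1, e2, e3⟩ := hind (d - 1) (by omega)
  rw [Nat.sub_add_cancel (by omega : 1 ≤ d), hxd, hlast', Finset.pair_comm w' w₀] at e1 e2 e3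
  exact ⟨by omega, e1, e2, e3⟩

end AbstractSimplicialComplex

/-! ### The recurrence of the reflection rule -/

/-- Subtracting the fixed point `m` leaves the homogeneous recurrence of `sin (iθ)`, whose solutions
have period `2π` in `iθ`. The closed form is kept multiplied by `sin θ`. -/
theorem recurrence_periodic_of_two_mul_cos {θ c : ℝ} {k : ℕ} (hθ : Real.sin θ ≠ 0)
    (hk : k * θ = 2 * Real.pi) {y : ℕ → ℝ}
    (hy : ∀ i, y (i + 2) = -1 * y i + 2 * Real.cos θ * (c + y (i + 1))) (i : ℕ) :
    y (i + k) = y i := by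
  have hcos : (2 - 2 * Real.cos θ) ≠ 0 := by
    intro h
    have h1 : Real.cos θ = 1 := by linarith
    have := Real.sin_sq_add_cos_sq θ
    rw [h1] at this
    exact hθ (by nlinarith)
  obtain ⟨m, hm⟩ : ∃ m, m * (2 - 2 * Real.cos θ) = 2 * Real.cos θ * c :=
    ⟨2 * Real.cos θ * c / (2 - 2 * Real.cos θ), div_mul_cancel₀ _ hcos⟩
  have hform : ∀ i : ℕ, Real.sin θ * (y i - m) =
        (y 1 - m) * Real.sin (i * θ) - (y 0 - m) * Real.sin (i * θ - θ) ∧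
      Real.sin θ * (y (i + 1) - m) =
        (y 1 - m) * Real.sin (i * θ + θ) - (y 0 - m) * Real.sin (i * θ) := by
    intro i
    induction i with
    | zero => constructor <;> simp <;> ring
    | succ i ih =>
      obtain ⟨h1, h2⟩ := ih
      have e1 : ((i + 1 : ℕ) : ℝ) * θ = i * θ + θ := by push_cast; ring
      have e2 : Real.sin (i * θ + θ + θ) =
          2 * Real.cos θ * Real.sin (i * θ + θ) - Real.sin (i * θ) := by
        have s1 := Real.sin_add (i * θ + θ) θ
        have s2 := Real.sin_sub (i * θ + θ) θ
        rw [add_sub_cancel_right] at s2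
        linear_combination s1 + s2
      have e3 : Real.sin (i * θ + θ) =
          2 * Real.cos θ * Real.sin (i * θ) - Real.sin (i * θ - θ) := by
        have s1 := Real.sin_add (i * θ) θ
        have s2 := Real.sin_sub (i * θ) θ
        linear_combination s1 + s2
      rw [e1, add_sub_cancel_right]
      refine ⟨h2, ?_⟩
      rw [e2, hy]
      linear_combination (2 * Real.cos θ) * h2 - h1 - Real.sin θ * hm + (y 0 - m) * e3
  suffices h : y (i + k) - m = y i - m by linarith
  apply mul_left_cancel₀ hθ
  rw [(hform (i + k)).1, (hform i).1]
  have e : ((i + k : ℕ) : ℝ) * θ = i * θ + 2 * Real.pi := by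
    push_cast
    linear_combination hk
  rw [e, Real.sin_add_two_pi, add_sub_right_comm, Real.sin_add_two_pi]

theorem dvd_of_cos_eq_one {k d : ℕ} (hk : 0 < k) (h : Real.cos (d * (2 * Real.pi / k)) = 1) :
    k ∣ d := by
  obtain ⟨n, hn⟩ := (Real.cos_eq_one_iff _).1 h
  have hk' : (k : ℝ) ≠ 0 := by positivity
  have h2 : (n : ℝ) * k = d := by
    have hpi := Real.pi_ne_zero
    field_simp at hn
    linear_combination hn
  have h3 : n * (k : ℤ) = d := by exact_mod_cast h2
  exact Int.natCast_dvd_natCast.1 ⟨n, by rw [← h3, mul_comm]⟩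

/-- The coefficients of the reflection rule for triangles with `k` of them around each vertex. -/
theorem exists_reflection_coefficients {k : ℕ} (hk : 2 ≤ k) :
    ∃ α β : ℝ, α * α = 1 ∧ α * β = -β ∧
      (∀ (c : ℝ) (y : ℕ → ℝ), (∀ i, y (i + 2) = α * y i + β * (c + y (i + 1))) →
        ∀ i, y (i + k) = y i) ∧
      ∀ i : ℕ, Real.cos ((i + 2 : ℕ) * (2 * Real.pi / k)) =
        α * Real.cos (i * (2 * Real.pi / k)) +
          β * (0 + Real.cos ((i + 1 : ℕ) * (2 * Real.pi / k))) := by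
  rcases hk.eq_or_lt with rfl | hk
  -- For `k = 2` the sine of `θ = π` vanishes and the general recurrence is not periodic. The
  -- degenerate tiling is a doubled triangle, where reflection keeps the label.
  · refine ⟨1, 0, by norm_num, by norm_num, fun c y hy i => by simpa using hy i, fun i => ?_⟩
    have : ((i + 2 : ℕ) : ℝ) * (2 * Real.pi / (2 : ℕ)) =
        i * (2 * Real.pi / (2 : ℕ)) + 2 * Real.pi := by
      push_cast
      ring
    rw [this, Real.cos_add_two_pi]
    ring
  · have hk0 : (0 : ℝ) < k := by positivity
    have hk3 : (3 : ℝ) ≤ k := by exact_mod_cast hk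
    have hsin : 0 < Real.sin (2 * Real.pi / k) := by
      apply Real.sin_pos_of_pos_of_lt_pi
      · have := Real.pi_pos
        positivity
      · rw [div_lt_iff₀ hk0]
        nlinarith [Real.pi_pos]
    refine ⟨-1, 2 * Real.cos (2 * Real.pi / k), by norm_num, by ring, fun c y hy =>
      recurrence_periodic_of_two_mul_cos hsin.ne' (by field_simp) hy, fun i => ?_⟩
    set θ := 2 * Real.pi / k
    have e1 : ((i + 2 : ℕ) : ℝ) * θ = (i * θ + θ) + θ := by push_cast; ring
    have e2 : ((i + 1 : ℕ) : ℝ) * θ = i * θ + θ := by push_cast; ring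
    have s1 := Real.cos_add (i * θ + θ) θ
    have s2 := Real.cos_sub (i * θ + θ) θ
    rw [add_sub_cancel_right] at s2
    rw [e1, e2]
    linear_combination s1 + s2

/-- A breadth-first spanning tree rooted at `a`: rank is the distance to `a`, and the parent is the
next vertex on a shortest path. -/
theorem SimpleGraph.Connected.exists_parent {V : Type*} {G : SimpleGraph V} (hG : G.Connected)
    (a : V) : ∃ (r : V → ℕ) (π : V → V), (∀ v, v ≠ a → r a < r v) ∧
      ∀ v, v ≠ a → G.Adj v (π v) ∧ r (π v) < r v := by
  have : ∀ v, ∃ u, v ≠ a → G.Adj v u ∧ G.dist u a < G.dist v a := by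
    intro v
    by_cases hv : v = a
    · exact ⟨v, fun h => absurd hv h⟩
    obtain ⟨p, hp⟩ := hG.exists_walk_length_eq_dist v a
    cases p with
    | nil => exact absurd rfl hv
    | cons h q =>
      refine ⟨_, fun _ => ⟨h, ?_⟩⟩
      have := SimpleGraph.dist_le q
      rw [SimpleGraph.Walk.length_cons] at hp
      omega
  choose π hπ using this
  exact ⟨fun v => G.dist v a, π, fun v hv => by simpa using hG.pos_dist_of_ne hv, hπ⟩

/-! ### The dual forest, consistent labels, and the monodromy argument -/

namespace AbstractSimplicialComplex

variable {V : Type*} [Fintype V] [DecidableEq V] {K : AbstractSimplicialComplex V}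

/-- The dual graph: triangles are joined when they share an edge outside `T`. -/
def dualGraph (K : AbstractSimplicialComplex V) (T : Set (Finset V)) : SimpleGraph (Finset V) where
  Adj s t := ∃ u v w w', K.IsTriangle u v w ∧ K.IsTriangle u v w' ∧ w ≠ w' ∧ s = {u, v, w} ∧
    t = {u, v, w'} ∧ {u, v} ∉ T
  symm := ⟨fun _ _ ⟨u, v, w, w', h1, h2, h3, h4, h5, h6⟩ =>
    ⟨u, v, w', w, h2, h1, h3.symm, h5, h4, h6⟩⟩
  loopless := ⟨by
    rintro _ ⟨u, v, w, w', h1, h2, h3, rfl, h5, -⟩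
    have : w ∈ ({u, v, w'} : Finset V) := h5 ▸ by simp
    have := h1.2
    grind⟩

/-- The edge `uv` lies in exactly two triangles, so the coboundary of its indicator is the sum of
theirs. Crossing an edge in the dual graph thus moves the endpoint of a path. -/
theorem sum_indicator_edge [Nontrivial V] (hX : PuncturesArePlanes K.realization)
    {u v w w' x y z : V} (h : K.IsTriangle u v w) (h' : K.IsTriangle u v w') (hne : w ≠ w')
    (hxyz : K.IsTriangle x y z) :
    ((if ({x, y} : Finset V) = {u, v} then 1 else 0) +
      (if ({y, z} : Finset V) = {u, v} then 1 else 0) +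
      (if ({x, z} : Finset V) = {u, v} then 1 else 0) : ZMod 2) =
    (if ({x, y, z} : Finset V) = {u, v, w} then 1 else 0) +
      (if ({x, y, z} : Finset V) = {u, v, w'} then 1 else 0) := by
  obtain ⟨hxy, hxz, hyz⟩ := hxyz.2
  have hdiff : ({u, v, w} : Finset V) ≠ {u, v, w'} := by
    intro h1
    have : w ∈ ({u, v, w'} : Finset V) := h1 ▸ by simp
    have := h.2
    grind
  have hright : {u, v} ⊆ ({x, y, z} : Finset V) →
      ((if ({x, y, z} : Finset V) = {u, v, w} then 1 else 0) +
      (if ({x, y, z} : Finset V) = {u, v, w'} then 1 else 0) : ZMod 2) = 1 := by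
    intro hs
    obtain ⟨w₃, h3, heq⟩ := exists_isTriangle_of_card hxyz.1 hxyz.card h.2.1 (hs (by simp))
      (hs (by simp))
    rw [heq]
    rcases eq_or_eq_of_isTriangle hX h h' h3 hne with rfl | rfl
    · simp [hdiff]
    · simp [hdiff.symm]
  by_cases h1 : ({x, y} : Finset V) = {u, v}
  · have h2 : ({y, z} : Finset V) ≠ {u, v} := by
      rw [← h1]
      intro h2
      have : z ∈ ({x, y} : Finset V) := h2 ▸ by simp
      grind
    have h3 : ({x, z} : Finset V) ≠ {u, v} := by
      rw [← h1]
      intro h2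
      have : z ∈ ({x, y} : Finset V) := h2 ▸ by simp
      grind
    rw [hright (h1 ▸ by grind), if_pos h1, if_neg h2, if_neg h3]
    norm_num
  by_cases h2 : ({y, z} : Finset V) = {u, v}
  · have h3 : ({x, z} : Finset V) ≠ {u, v} := by
      rw [← h2]
      intro h3
      have : x ∈ ({y, z} : Finset V) := h3 ▸ by simp
      grind
    rw [hright (h2 ▸ by grind), if_neg h1, if_pos h2, if_neg h3]
    norm_num
  by_cases h3 : ({x, z} : Finset V) = {u, v}
  · rw [hright (h3 ▸ by grind), if_neg h1, if_neg h2, if_pos h3]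
    norm_num
  have hsub : ¬ {u, v} ⊆ ({x, y, z} : Finset V) := by
    intro hs
    have hu : u ∈ ({x, y, z} : Finset V) := hs (by simp)
    have hv : v ∈ ({x, y, z} : Finset V) := hs (by simp)
    have huv := h.2.1
    simp only [Finset.mem_insert, Finset.mem_singleton] at hu hv
    have hc := Finset.pair_comm u v
    rcases hu with rfl | rfl | rfl <;> rcases hv with rfl | rfl | rfl <;> simp_all
  have hneq : ∀ q, ({x, y, z} : Finset V) ≠ {u, v, q} := fun q hq => hsub (hq ▸ by grind)
  simp [h1, h2, h3, hneq]

/-- The edges not in a connected spanning graph are crossed by no closed curve. -/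
theorem dualGraph_isAcyclic [Nontrivial V] (hX : PuncturesArePlanes K.realization)
    {T : Set (Finset V)}
    (hT : ∀ f : V → ZMod 2, (∀ u v, K.oneSkeleton.Adj u v → {u, v} ∈ T → f u = f v) →
      ∀ u v, f u = f v) : (K.dualGraph T).IsAcyclic := by
  classical
  have h2z : ∀ a : ZMod 2, a + a = 0 := CharTwo.add_self_eq_zero
  rw [SimpleGraph.isAcyclic_iff_forall_adj_isBridge]
  intro s t hst
  rw [SimpleGraph.isBridge_iff]
  intro hreach
  obtain ⟨u, v, w, w', hw, hw', hne, hs, ht, huv⟩ := hst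
  -- Here `c` counts mod 2 how often the dual path crosses each edge; its coboundary is supported at
  -- the two ends of the path.
  have key : ∀ t', Relation.ReflTransGen ((K.dualGraph T).deleteEdges {s(s, t)}).Adj s t' →
      ∃ c : Finset V → ZMod 2, (∀ e ∈ T, c e = 0) ∧ c {u, v} = 0 ∧
      ∀ x y z, K.IsTriangle x y z → c {x, y} + c {y, z} + c {x, z} =
        (if ({x, y, z} : Finset V) = s then 1 else 0) +
        (if ({x, y, z} : Finset V) = t' then 1 else 0) := by
    intro t' hreach
    induction hreach with
    | refl => exact ⟨0, by simp, by simp, fun x y z _ => by simp [h2z]⟩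
    | tail _ hadj ih =>
      rename_i r z _
      obtain ⟨c, hc, hc0, hcs⟩ := ih
      rw [SimpleGraph.deleteEdges_adj] at hadj
      obtain ⟨⟨u', v', x, x', hx, hx', hnex, hr, hr', huv'⟩, hdel⟩ := hadj
      -- Only two triangles contain `uv`, so crossing it would use the deleted dual edge.
      have hne' : ({u, v} : Finset V) ≠ {u', v'} := by
        intro heq
        have hins : ∀ q : V, ({u', v', q} : Finset V) = {u, v, q} := by
          intro q
          have h1 : ({u', v', q} : Finset V) = {u', v'} ∪ {q} := by grind
          have h2 : ({u, v, q} : Finset V) = {u, v} ∪ {q} := by grind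
          rw [h1, h2, heq]
        have hq : ∀ q, K.IsTriangle u' v' q → q = w ∨ q = w' := by
          intro q hq
          refine eq_or_eq_of_isTriangle hX hw hw' ⟨hins q ▸ hq.1, hw.2.1, ?_⟩ hne
          have hq' : q ∉ ({u', v'} : Finset V) := by
            have := hq.2
            grind
          rw [← heq] at hq'
          grind
        apply hdel
        rw [Set.mem_singleton_iff, hr, hr', hins, hins, hs, ht]
        rcases hq x hx with rfl | rfl <;> rcases hq x' hx' with rfl | rfl
        · exact absurd rfl hnex
        · rfl
        · exact Sym2.eq_swap
        · exact absurd rfl hnex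
      refine ⟨fun e => c e + if e = {u', v'} then 1 else 0, fun e he => ?_, ?_, fun a b d h => ?_⟩
      · have : e ≠ {u', v'} := by
          rintro rfl
          exact huv' he
        simp only [this, if_false, hc e he, add_zero]
      · simp only [hne', if_false, hc0, add_zero]
      · have h1 := hcs a b d h
        have h2 := sum_indicator_edge hX hx hx' hnex h
        rw [← hr, ← hr'] at h2
        linear_combination h1 + h2 + h2z (if ({a, b, d} : Finset V) = r then 1 else 0)
  obtain ⟨c, hcT, hc0, hc⟩ := key t ((SimpleGraph.reachable_iff_reflTransGen _ _).1 hreach)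
  -- Adding the crossing of `uv` closes the path to a cocycle. Its potential is constant along `T`,
  -- hence constant, although the cocycle is `1` on `uv`.
  obtain ⟨f, hf⟩ := exists_splitting_of_triangle_sum_eq_zero hX
    (fun e => c e + if e = {u, v} then 1 else 0) (by
      intro x y z h
      have h1 := hc x y z h
      have h2 := sum_indicator_edge hX hw hw' hne h
      rw [← hs, ← ht] at h2
      linear_combination h1 + h2 + h2z (if ({x, y, z} : Finset V) = s then 1 else 0) +
        h2z (if ({x, y, z} : Finset V) = t then 1 else 0))
  have hconst := hT f fun x y hxy hxyT => by
    have := hf x y hxy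
    have hxyuv : ({x, y} : Finset V) ≠ {u, v} := fun h => huv (h ▸ hxyT)
    rw [hcT _ hxyT, if_neg hxyuv, add_zero] at this
    exact CharTwo.add_eq_zero.1 this.symm
  have := hf u v hw.adj
  rw [hc0, if_pos rfl, hconst u v, h2z] at this
  simp at this

/-- The two triangles at an edge outside a connected spanning graph `T` can be labelled
consistently, with prescribed labels on one triangle. -/
theorem exists_consistent_labelling [Nontrivial V] (hX : PuncturesArePlanes K.realization)
    {T : Set (Finset V)}
    (hT : ∀ f : V → ZMod 2, (∀ u v, K.oneSkeleton.Adj u v → {u, v} ∈ T → f u = f v) →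
      ∀ u v, f u = f v) {α β : ℝ} (hα : α * α = 1) (hαβ : α * β = -β) (t₀ : Finset V)
    (q₀ : V → ℝ) :
    ∃ p : Finset V → V → ℝ, p t₀ = q₀ ∧ ∀ u v, {u, v} ∉ T → K.ConsistentAt α β p u v := by
  classical
  obtain ⟨p, hp0, hp⟩ := (dualGraph_isAcyclic hX hT).exists_labelling
    (R := fun s t q q' => ∀ u v w w', K.IsTriangle u v w → K.IsTriangle u v w' → w ≠ w' →
      s = {u, v, w} → t = {u, v, w'} → Glues α β q q' u v w w')
    -- The relations `α² = 1` and `αβ = -β` say exactly that the reflection rule is an involution.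
    (fun s t q q' _ h u v w w' hw hw' hne hs ht => by
      obtain ⟨h1, h2, h3⟩ := h u v w' w hw' hw hne.symm ht hs
      refine ⟨h1.symm, h2.symm, ?_⟩
      rw [h3, h1, h2]
      linear_combination -q w' * hα - (q u + q v) * hαβ)
    (fun s t q hst => by
      obtain ⟨u, v, w, w', hw, hw', hne, hs, ht, -⟩ := hst
      refine ⟨fun x => if x = w' then α * q w + β * (q u + q v) else q x, ?_⟩
      intro u₁ v₁ w₁ w₁' h₁ h₁' hne₁ hs₁ ht₁
      have hs' : ∀ x, x ∈ ({u, v, w} : Finset V) ↔ x ∈ ({u₁, v₁, w₁} : Finset V) := by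
        rw [← hs, ← hs₁]; simp
      have ht' : ∀ x, x ∈ ({u, v, w'} : Finset V) ↔ x ∈ ({u₁, v₁, w₁'} : Finset V) := by
        rw [← ht, ← ht₁]; simp
      simp only [Finset.mem_insert, Finset.mem_singleton] at hs' ht'
      have d := hw.2
      have d' := hw'.2
      have d₁ := h₁.2
      have d₁' := h₁'.2
      have hww : w₁ = w := by
        have := hs' w₁
        have := ht' w₁
        grind
      have hww' : w₁' = w' := by
        have := hs' w₁'
        have := ht' w₁'
        grind
      subst hww hww'
      have huv : (u₁ = u ∧ v₁ = v) ∨ (u₁ = v ∧ v₁ = u) := by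
        have := hs' u₁
        have := hs' v₁
        grind
      rcases huv with ⟨rfl, rfl⟩ | ⟨rfl, rfl⟩
      · simp [Glues, d'.2.1, d'.2.2]
      · simp [Glues, d'.2.1, d'.2.2, add_comm]) t₀ q₀
  refine ⟨p, hp0, fun u v huv w w' hw hw' hne => ?_⟩
  exact hp _ _ ⟨u, v, w, w', hw, hw', hne, rfl, rfl, huv⟩ u v w w' hw hw' hne rfl rfl

/-- If the labels are consistent at all edges around `v` but one, and `k` divides the degree of
`v`, then they are consistent at the remaining edge. -/
theorem consistentAt_of_dvd [Nontrivial V] (hX : PuncturesArePlanes K.realization) {α β : ℝ}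
    {k : ℕ} (hper : ∀ (c : ℝ) (y : ℕ → ℝ), (∀ i, y (i + 2) = α * y i + β * (c + y (i + 1))) →
      ∀ i, y (i + k) = y i) {p : Finset V → V → ℝ} {v w₀ : V}
    (hk : k ∣ (K.oneSkeleton.neighborSet v).ncard)
    (hcons : ∀ w, K.oneSkeleton.Adj v w → w ≠ w₀ → K.ConsistentAt α β p v w) :
    K.ConsistentAt α β p v w₀ := by
  intro w' w₁ hw' hw₁ hne
  let c := p {v, w₀, w₁} v
  let s : ℕ → ℝ × ℝ := fun n =>
    Nat.rec (p {v, w₀, w₁} w₀, p {v, w₀, w₁} w₁) (fun _ x => (x.2, α * x.1 + β * (c + x.2))) n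
  let y : ℕ → ℝ := fun n => (s n).1
  have hy : ∀ i, y (i + 2) = α * y i + β * (c + y (i + 1)) := fun i => rfl
  obtain ⟨h0, h1, h2, h3⟩ := apply_of_consistentAt_link hX hw₁ hw' hne.symm hcons y rfl rfl hy
  obtain ⟨m, hm⟩ := hk
  have hmul : ∀ j i, y (i + k * j) = y i := by
    intro j
    induction j with
    | zero => simp
    | succ j ih =>
      intro i
      rw [Nat.mul_succ, ← add_assoc, hper c y hy, ih]
  have e0 : y (K.oneSkeleton.neighborSet v).ncard = y 0 := by
    have := hmul m 0
    rwa [zero_add, ← hm] at this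
  -- With `d` the degree, the recurrence at index `d - 1` involves `y (d - 1)`, `y d = y 0` and `y
  -- (d + 1) = y 1`. This is the gluing rule across the one edge not yet known.
  have e1 : y ((K.oneSkeleton.neighborSet v).ncard - 1 + 2) = y 1 := by
    have hn : (K.oneSkeleton.neighborSet v).ncard - 1 + 2 =
        1 + (K.oneSkeleton.neighborSet v).ncard := by omega
    rw [hn, hm]
    exact hmul m 1
  have e2 := hy ((K.oneSkeleton.neighborSet v).ncard - 1)
  rw [e1, Nat.sub_add_cancel h0] at e2
  refine ⟨h1.symm, ?_, ?_⟩
  · exact (h3.trans e0).symm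
  · rw [h1, h2, h3]
    exact e2

/-- If `k` divides the degrees of all vertices but the ends `a`, `b` of an edge, then it divides
the degree of `a`. -/
theorem dvd_degree_of_adj (hX : PuncturesArePlanes K.realization) {a b : V}
    (hab : K.oneSkeleton.Adj a b) {k : ℕ} (hk : 2 ≤ k)
    (hdeg : ∀ v, v ≠ a → v ≠ b → k ∣ (K.oneSkeleton.neighborSet v).ncard) :
    k ∣ (K.oneSkeleton.neighborSet a).ncard := by
  have : Nontrivial V := ⟨a, b, hab.1⟩
  obtain ⟨α, β, hα, hαβ, hper, hcos⟩ := exists_reflection_coefficients hk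
  obtain ⟨r, π', hra, hπ'⟩ := (oneSkeleton_connected hX).exists_parent a
  -- Rerouting the parent of `b` to `a` puts the edge `ab` in the spanning tree, and ranks still
  -- decrease.
  let π := Function.update π' b a
  have hπb : π b = a := Function.update_self ..
  have hπ : ∀ v, v ≠ a → K.oneSkeleton.Adj v (π v) ∧ r (π v) < r v := by
    intro v hv
    by_cases hvb : v = b
    · subst hvb
      rw [hπb]
      exact ⟨hab.symm, hra v hv⟩
    · simp only [π, Function.update_of_ne hvb]
      exact hπ' v hv
  let T : Set (Finset V) := {e | ∃ v, v ≠ a ∧ e = {v, π v}}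
  have hT : ∀ f : V → ZMod 2, (∀ u v, K.oneSkeleton.Adj u v → {u, v} ∈ T → f u = f v) →
      ∀ u v, f u = f v := by
    intro f hf
    have key : ∀ n, ∀ v, r v = n → f v = f a := by
      intro n
      induction n using Nat.strong_induction_on with
      | _ n ih =>
        intro v hv
        by_cases hva : v = a
        · rw [hva]
        · obtain ⟨h1, h2⟩ := hπ v hva
          rw [hf v (π v) h1 ⟨v, hva, rfl⟩]
          exact ih _ (hv ▸ h2) _ rfl
    exact fun u v => (key _ u rfl).trans (key _ v rfl).symm
  obtain ⟨c, c', hcc, htri⟩ := exists_two_triangles hX hab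
  have hc := (htri c).2 (Or.inl rfl)
  have hc' := (htri c').2 (Or.inr rfl)
  let θ := 2 * Real.pi / k
  let y : ℕ → ℝ := fun i => Real.cos (i * θ)
  obtain ⟨p, hp0, hp⟩ := exists_consistent_labelling hX hT hα hαβ {a, b, c}
    (fun x => if x = a then 0 else if x = b then 1 else Real.cos θ)
  have hpa : p {a, b, c} a = 0 := by simp [hp0]
  have hpb : p {a, b, c} b = 1 := by simp [hp0, hc.2.1.symm]
  have hpc : p {a, b, c} c = Real.cos θ := by simp [hp0, hc.2.2.1.symm, hc.2.2.2.symm]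
  obtain ⟨N, hN⟩ : ∃ N, ∀ v, r v ≤ N := by
    obtain ⟨N, hN⟩ := (Set.finite_range r).bddAbove
    exact ⟨N, fun v => hN ⟨v, rfl⟩⟩
  -- Induction from the vertices of largest rank: every tree edge at `v` except the one to its
  -- parent leads to a child. For `n = 0` there are no children.
  have hparent : ∀ n, ∀ v, v ≠ a → v ≠ b → N ≤ r v + n → K.ConsistentAt α β p v (π v) := by
    intro n
    induction n with
    | zero =>
      intro v hva hvb hn
      refine consistentAt_of_dvd hX hper (hdeg v hva hvb) fun w hw hwne => hp v w ?_
      rintro ⟨u, hua, hu⟩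
      have h1 : v ∈ ({u, π u} : Finset V) := hu ▸ by simp
      have h2 : w ∈ ({u, π u} : Finset V) := hu ▸ by simp
      have h3 := (hπ u hua).2
      have h4 := hN u
      have := hw.1
      grind
    | succ n ih =>
      intro v hva hvb hn
      refine consistentAt_of_dvd hX hper (hdeg v hva hvb) fun w hw hwne => ?_
      by_cases hwT : {v, w} ∈ T
      · obtain ⟨u, hua, hu⟩ := hwT
        have h1 : v ∈ ({u, π u} : Finset V) := hu ▸ by simp
        have h2 : w ∈ ({u, π u} : Finset V) := hu ▸ by simp
        have hvw := hw.1
        have huw : u = w ∧ π u = v := by grind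
        obtain ⟨rfl, hv⟩ := huw
        have hub : u ≠ b := by
          rintro rfl
          exact hva (hv.symm.trans hπb)
        have := (hπ u hua).2
        have hcons := ih u hua hub (by rw [hv] at this; omega)
        rw [hv] at hcons
        exact hcons.symm
      · exact hp v w hwT
  have hcons : ∀ u v, ({u, v} : Finset V) ≠ {a, b} → K.ConsistentAt α β p u v := by
    intro u v huv
    by_cases huvT : {u, v} ∈ T
    · obtain ⟨x, hxa, hx⟩ := huvT
      have hxb : x ≠ b := by
        rintro rfl
        apply huv
        rw [hx, hπb, Finset.pair_comm]
      have hx' := hparent N x hxa hxb (by omega)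
      have hne := (hπ x hxa).1.1
      have h1 : x ∈ ({u, v} : Finset V) := hx ▸ by simp
      have h2 : π x ∈ ({u, v} : Finset V) := hx ▸ by simp
      have : (x = u ∧ π x = v) ∨ (x = v ∧ π x = u) := by grind
      rcases this with ⟨rfl, rfl⟩ | ⟨rfl, rfl⟩
      · exact hx'
      · exact hx'.symm
    · exact hp u v huvT
  -- Since `a` has label `0`, the sequence `cos (iθ)` solves the recurrence around `a` with the
  -- chosen initial labels.
  obtain ⟨-, -, -, ha⟩ := apply_of_consistentAt_link hX hc hc' hcc
    (fun w hw hwb => hcons a w (by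
      intro h
      have : w ∈ ({a, b} : Finset V) := h ▸ by simp
      have := hw.1
      grind)) y (by rw [hpb]; simp [y]) (by rw [hpc]; simp [y])
    (fun i => by rw [hpa]; exact hcos i)
  -- The turn around `b` is needed only for the invariance of the label of `b` itself, so no
  -- explicit solution is required.
  obtain ⟨-, hb, -, -⟩ := by
    let s : ℕ → ℝ × ℝ := fun n => Nat.rec (p {b, a, c} a, p {b, a, c} c)
      (fun _ x => (x.2, α * x.1 + β * (p {b, a, c} b + x.2))) n
    exact apply_of_consistentAt_link hX hc.swap hc'.swap hcc
      (fun w hw hwb => hcons b w (by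
        intro h
        have : w ∈ ({a, b} : Finset V) := h ▸ by simp
        have := hw.1
        grind)) (fun n => (s n).1) rfl rfl (fun i => rfl)
  rw [Finset.insert_comm b a, Finset.insert_comm b a, ha, hpb] at hb
  exact dvd_of_cos_eq_one (by omega) hb

end AbstractSimplicialComplex

/-! ### Transfer back to the geometric complex -/

namespace Geometry.SimplicialComplex

variable {E : Type*} [NormedAddCommGroup E] [NormedSpace ℝ E]

theorem toAbstract_adj_iff {K : SimplicialComplex ℝ E} [DecidableEq K.vertices]
    {v w : K.vertices} : K.toAbstract.oneSkeleton.Adj v w ↔ K.edgeGraph.Adj v w := by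
  classical
  have hpair : ∀ e : Finset E, (e : Set E) = {(v : E), (w : E)} ↔ e = {(v : E), (w : E)} := by
    intro e
    rw [← Finset.coe_inj, Finset.coe_pair]
  change v ≠ w ∧ ({v, w} : Finset K.vertices).map (Function.Embedding.subtype _) ∈ K.faces ↔
    (v : E) ≠ w ∧ ∃ e ∈ K.faces, (e : Set E) = {(v : E), (w : E)}
  simp only [hpair, exists_eq_right, ne_eq, Subtype.ext_iff, Finset.map_insert,
    Finset.map_singleton, Function.Embedding.subtype_apply]

theorem mem_vertices_of_adj {K : SimplicialComplex ℝ E} {v w : E} (h : K.edgeGraph.Adj v w) :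
    w ∈ K.vertices := by
  obtain ⟨-, e, he, hvw⟩ := h
  refine K.down_closed he ?_ (Finset.singleton_nonempty w)
  rw [Finset.singleton_subset_iff, ← Finset.mem_coe, hvw]
  simp

theorem ncard_neighborSet_toAbstract {K : SimplicialComplex ℝ E} [DecidableEq K.vertices]
    (v : K.vertices) : (K.toAbstract.oneSkeleton.neighborSet v).ncard = K.vertexDegree v := by
  have : K.edgeGraph.neighborSet v =
      Subtype.val '' (K.toAbstract.oneSkeleton.neighborSet v) := by
    ext w
    constructor
    · intro h
      exact ⟨⟨w, mem_vertices_of_adj h⟩, toAbstract_adj_iff.2 h, rfl⟩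
    · rintro ⟨w, h, rfl⟩
      exact toAbstract_adj_iff.1 h
  rw [vertexDegree, this, Set.ncard_image_of_injective _ Subtype.val_injective]

end Geometry.SimplicialComplex

theorem theorem2 {E : Type*} [NormedAddCommGroup E] [NormedSpace ℝ E]
    (k : ℕ) (hk : 0 < k)
    (K : Geometry.SimplicialComplex ℝ E) (hK : K.TriangulatesSphere)
    (a b : E) (hab : a ≠ b)
    (hexc : {v | v ∈ K.vertices ∧ ¬ k ∣ K.vertexDegree v} = {a, b}) :
    ¬ K.edgeGraph.Adj a b := by
  classical
  intro hadj
  have : Fintype K.vertices := hK.finite_vertices.fintype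
  have hmem : ∀ v, (v ∈ K.vertices ∧ ¬ k ∣ K.vertexDegree v) ↔ v = a ∨ v = b := fun v => by
    have := Set.ext_iff.1 hexc v
    simpa using this
  obtain ⟨ha, hka⟩ := (hmem a).2 (Or.inl rfl)
  obtain ⟨hb, -⟩ := (hmem b).2 (Or.inr rfl)
  have hk2 : 2 ≤ k := by
    by_contra h
    obtain rfl : k = 1 := by omega
    exact hka (one_dvd _)
  apply hka
  rw [← Geometry.SimplicialComplex.ncard_neighborSet_toAbstract ⟨a, ha⟩]
  refine AbstractSimplicialComplex.dvd_degree_of_adj hK.puncturesArePlanes (b := ⟨b, hb⟩)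
    (Geometry.SimplicialComplex.toAbstract_adj_iff.2 hadj) hk2 fun v hva hvb => ?_
  rw [Geometry.SimplicialComplex.ncard_neighborSet_toAbstract]
  by_contra hdvd
  rcases (hmem v).1 ⟨v.2, hdvd⟩ with h | h
  · exact hva (Subtype.ext h)
  · exact hvb (Subtype.ext h)
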